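/- Let $\mathbb T=\mathbb R/2\pi\mathbb Z$, let $dx$ be Lebesgue measure on $\mathbb T$ (total mass $2\pi$), and let $V:\mathbb T\to\mathbb R$ be of class $C^{1,1}$ (differentiable with Lipschitz derivative). For $\beta>0$ and a potential $W:\mathbb T\to\mathbb R$ of class $C^{1,1}$, let $\mu_0^W$ be the probability measure proportional to $e^{-W(x)}dx$, and let $\mu_\beta^W$ be the unique minimizer over probability measures $\mu$ on $\mathbb T$ of $$F_\beta^W(\mu)=\beta\iint\log\Big|\sin\frac{x-y}{2}\Big|^{-1}\mu(dx)\,\mu(dy)+\mathcal K(\mu\,|\,\mu_0^W),$$ where $\mathcal K$ is the relative entropy. The measure $\mu_\beta^W$ has a continuous density with respect to $dx$, also written $\mu_\beta^W(x)$. Let $H$ be the Hilbert transform $$Hf(x)=-\,\mathrm{p.v.}\int_{\mathbb T}\frac{f(t)}{\tan\frac{x-t}{2}}\,\frac{dt}{2\pi},$$ where the principal value is the limit as $\varepsilon\to0$ of the integral over $|e^{ix}-e^{it}|>\varepsilon$. Let $\mathcal H$ be the space of real $\psi\in H^1(\mathbb T)$ with $\int\psi\,d\mu_\beta^W=0$,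 with inner product $\langle\phi,\psi\rangle_{\mathcal H}=\int\phi'\psi'\,d\mu_\beta^W$, and let $$-\mathscr L\phi=\phi''+2\pi\beta\,H(\mu_\beta^W\phi')+(\log\mu_\beta^W)'\phi',$$ where derivatives are in the sense of distributions. As an operator on $\mathcal H$, $\mathscr L$ is taken modulo additive constants: for $\psi\in\mathcal H$, $\mathscr L^{-1}\psi$ is the unique $\phi\in\mathcal H\cap H^2(\mathbb T)$ such that $\mathscr L\phi-\int\mathscr L\phi\,d\mu_\beta^W=\psi$ almost everywhere. For $\psi\in H^1(\mathbb T)$ put $\psi_\beta=\psi-\int\psi\,d\mu_\beta^W$ and $$\sigma_\beta^W(\psi)^2=\langle\psi_\beta,\mathscr L^{-1}\psi_\beta\rangle_{\mathcal H}=\int\psi'\,(\mathscr L^{-1}\psi_\beta)'\,d\mu_\beta^W .$$ Finally let $\|\psi\|_{H^{1/2}}^2=2\sum_{k\ge1}k\,|\hat\psi_k|^2$ with $\hat\psi_k=\int_{\mathbb T}\psi(x)e^{-ikx}\frac{dx}{2\pi}$. Let $\psi\in H^2(\mathbb T)$ be real-valued. If $\beta\min_{\mathbb T}\mu_\beta^{V}\to\infty$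 as $\beta\to\infty$, then $$\lim_{\beta\to\infty}\beta\,\sigma_\beta^{V}(\psi)^2=\|\psi\|_{H^{1/2}}^2 .$$ If instead $\beta\min_{\mathbb T}\mu_\beta^{\beta V}\to\infty$ as $\beta\to\infty$ (where $\mu_\beta^{\beta V}$ and $\sigma_\beta^{\beta V}$ are the objects above for the potential $W=\beta V$), then $$\lim_{\beta\to\infty}\beta\,\sigma_\beta^{\beta V}(\psi)^2=\|\psi\|_{H^{1/2}}^2 .$$ -/

import Mathlib

open MeasureTheory Filter Topology
open scoped Real ENNReal ContDiff

namespace TorusGas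

noncomputable section

/-- The torus `ℝ / 2πℤ`. Its `volume` is Lebesgue measure `dx`, of total mass `2π`; its distance is
`d(x, y) = inf_k |x - y + 2πk|`. -/
abbrev Torus : Type := AddCircle (2 * π)

instance factTwoPiPos : Fact (0 < 2 * π) := ⟨Real.two_pi_pos⟩

/-- The `2π`-periodic function on the line attached to a function on the torus. -/
def periodize (f : Torus → ℝ) : ℝ → ℝ := fun t => f (t : Torus)

theorem periodize_periodic (f : Torus → ℝ) : Function.Periodic (periodize f) (2 * π) := by
  intro t
  simp [periodize]

theorem deriv_periodize_periodic (f : Torus → ℝ) :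
    Function.Periodic (deriv (periodize f)) (2 * π) := by
  intro t
  rw [← deriv_comp_add_const]
  congr 1
  funext s
  exact periodize_periodic f s

/-- The classical derivative of a function on the torus. -/
def torusDeriv (f : Torus → ℝ) : Torus → ℝ := (deriv_periodize_periodic f).lift

/-- `V` is of class `C^{1,1}`: differentiable with Lipschitz derivative. -/
def IsC11 (V : Torus → ℝ) : Prop :=
  Differentiable ℝ (periodize V) ∧ ∃ K : NNReal, LipschitzWith K (torusDeriv V)

/-! ### Sobolev spaces -/

/-- `g` is the distributional derivative of `f` on the torus. -/
def HasWeakDeriv (f g : Torus → ℝ) : Prop :=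
  ∀ η : Torus → ℝ, ContDiff ℝ ∞ (periodize η) →
    ∫ x, f x * torusDeriv η x = -∫ x, g x * η x

/-- The Sobolev space `H^m` of `L²` functions whose first `m` distributional derivatives
are in `L²`. -/
def MemH : ℕ → (Torus → ℝ) → Prop
  | 0, f => MemLp f 2 volume
  | m + 1, f => MemLp f 2 volume ∧ ∃ g, HasWeakDeriv f g ∧ MemH m g

open Classical in
/-- The `L²` distributional derivative (it is unique up to null sets; the value is `0` if there
is none). -/
def weakDeriv (f : Torus → ℝ) : Torus → ℝ :=
  if h : ∃ g, MemLp g 2 volume ∧ HasWeakDeriv f g then h.choose else 0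

/-- `‖ψ‖²_{H^{1/2}} = 2 ∑_{k ≥ 1} k |ψ̂_k|²` with `ψ̂_k = ∫ ψ(x) e^{-ikx} dx / 2π`. -/
def hHalfSq (ψ : Torus → ℝ) : ℝ :=
  2 * ∑' k : ℕ, (k : ℝ) * ‖fourierCoeff (fun x : Torus => (ψ x : ℂ)) (k : ℤ)‖ ^ 2

/-! ### The Hilbert transform -/

theorem inv_tan_half_periodic : Function.Periodic (fun t : ℝ => (Real.tan (t / 2))⁻¹) (2 * π) := by
  intro t
  have h : (t + 2 * π) / 2 = t / 2 + π := by ring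
  simp only [h, Real.tan_periodic (t / 2)]

/-- The function `x ↦ 1 / tan (x / 2)` on the torus. -/
def invTanHalf : Torus → ℝ := inv_tan_half_periodic.lift

theorem abs_sin_half_periodic : Function.Periodic (fun t : ℝ => |Real.sin (t / 2)|) (2 * π) := by
  intro t
  have h : (t + 2 * π) / 2 = t / 2 + π := by ring
  simp only [h, Real.sin_add_pi, abs_neg]

/-- The function `x ↦ |sin (x / 2)|` on the torus; thus `|e^{ix} - e^{iy}| = 2 |sin ((x-y)/2)|`. -/
def absSinHalf : Torus → ℝ := abs_sin_half_periodic.lift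

/-- `∫ f(t) / tan((x-t)/2) dt / 2π` over the set of `t` with `|e^{ix} - e^{it}| > ε`. -/
def truncatedHilbert (f : Torus → ℝ) (x : Torus) (ε : ℝ) : ℝ :=
  (2 * π)⁻¹ * ∫ t in {t : Torus | ε < 2 * absSinHalf (x - t)}, f t * invTanHalf (x - t)

/-- The Hilbert transform `Hf(x) = - p.v. ∫ f(t) / tan((x-t)/2) dt / 2π`. -/
def hilbert (f : Torus → ℝ) (x : Torus) : ℝ :=
  -limUnder (𝓝[>] (0 : ℝ)) (truncatedHilbert f x)

/-! ### The equilibrium measure -/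

open Classical in
/-- The kernel `log |sin (x / 2)|⁻¹ ∈ [0, ∞]`. -/
def logKernel (x : Torus) : ℝ≥0∞ :=
  if x = 0 then ⊤ else ENNReal.ofReal (-Real.log (absSinHalf x))

/-- The logarithmic energy `∬ log |sin ((x-y)/2)|⁻¹ μ(dx) μ(dy)`. -/
def logEnergy (μ : Measure Torus) : ℝ≥0∞ := ∫⁻ x, ∫⁻ y, logKernel (x - y) ∂μ ∂μ

/-- The probability measure proportional to `e^{-V} dx`. -/
def refMeasure (V : Torus → ℝ) : Measure Torus := (volume : Measure Torus).tilted fun x => -V x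

/-- The functional `F_β^V(μ) = β E(μ) + K(μ | μ_0^V)`, with `K` the relative entropy. -/
def freeEnergy (β : ℝ) (V : Torus → ℝ) (μ : ProbabilityMeasure Torus) : ℝ≥0∞ :=
  ENNReal.ofReal β * logEnergy (μ : Measure Torus)
    + InformationTheory.klDiv (μ : Measure Torus) (refMeasure V)

open Classical in
/-- The minimizer `μ_β^V` of `F_β^V` over probability measures. -/
def eqMeasure (β : ℝ) (V : Torus → ℝ) : Measure Torus :=
  if h : ∃ μ : ProbabilityMeasure Torus, ∀ ν, freeEnergy β V μ ≤ freeEnergy β V ν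
  then (h.choose : Measure Torus) else 0

open Classical in
/-- The (continuous) density `μ_β^V(x)` of the equilibrium measure with respect to `dx`. -/
def eqDensity (β : ℝ) (V : Torus → ℝ) : Torus → ℝ :=
  if h : ∃ m : Torus → ℝ, Continuous m ∧ (∀ x, 0 ≤ m x) ∧
      eqMeasure β V = volume.withDensity fun x => ENNReal.ofReal (m x)
  then h.choose else 0

/-! ### The operator and the variance -/

/-- `f - ∫ f dμ_β^V`. -/
def centered (β : ℝ) (V f : Torus → ℝ) : Torus → ℝ := fun x => f x - ∫ y, f y ∂eqMeasure β V

/-- The Hilbert space of `ψ ∈ H¹` with `∫ ψ dμ_β^V = 0`. -/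
def MemHi (β : ℝ) (V ψ : Torus → ℝ) : Prop := MemH 1 ψ ∧ ∫ x, ψ x ∂eqMeasure β V = 0

/-- The inner product `∫ φ' ψ' dμ_β^V`. -/
def innerHi (β : ℝ) (V φ ψ : Torus → ℝ) : ℝ :=
  ∫ x, weakDeriv φ x * weakDeriv ψ x ∂eqMeasure β V

/-- The operator `-𝓛φ = φ'' + 2πβ H(μ_β^V φ') + (log μ_β^V)' φ'`. -/
def opL (β : ℝ) (V φ : Torus → ℝ) : Torus → ℝ := fun x =>
  -(weakDeriv (weakDeriv φ) x
    + 2 * π * β * hilbert (fun t => eqDensity β V t * weakDeriv φ t) x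
    + weakDeriv (fun t => Real.log (eqDensity β V t)) x * weakDeriv φ x)

/-- `φ` is the preimage of `ψ` under `𝓛` as an operator on the Hilbert space of functions with
`∫ · dμ_β^V = 0`. The inner product of this space does not see additive constants, and the value
`𝓛φ` is brought back into the space by subtracting its mean. -/
def IsInvL (β : ℝ) (V ψ φ : Torus → ℝ) : Prop :=
  MemHi β V φ ∧ MemH 2 φ ∧ centered β V (opL β V φ) =ᵐ[volume] ψ

open Classical in
/-- `𝓛⁻¹ψ`. -/
def invL (β : ℝ) (V ψ : Torus → ℝ) : Torus → ℝ :=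
  if h : ∃ φ, IsInvL β V ψ φ then h.choose else 0

/-- The variance `σ_β^V(ψ)² = ⟨ψ_β, 𝓛⁻¹ ψ_β⟩`, where `ψ_β = ψ - ∫ ψ dμ_β^V`. -/
def sigmaSq (β : ℝ) (V ψ : Torus → ℝ) : ℝ :=
  innerHi β V (centered β V ψ) (invL β V (centered β V ψ))

end

end TorusGas

namespace TorusGas

noncomputable section

open AddCircle
open scoped ComplexConjugate

/-! ### Fourier coefficients of real functions -/

/-! Write `m` for the equilibrium density, `u = m φ'` and `g = u'`. Since `φ'' + (log m)' φ' = (m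
φ')' / m`, the equation for `φ = 𝓛⁻¹ψ_β` becomes `g / m + 2πβ Hu = -ψ + c` with a constant `c`, and
an integration by parts turns the variance into `σ² = ∫ ψ' u = -∫ ψ g`. The Hilbert transform has
the Fourier multiplier `i sgn k` and `g` has coefficients `i k û_k`, so `Hu = |D|⁻¹ g` on the
Fourier side: the problem is a positive multiplication operator plus a positive Fourier multiplier.

Dropping `g / m`, which is formally of relative size `1 / (β m)`, leaves `βg ≈ w := -|D|ψ / 2π`, and
`-∫ ψ w` is exactly the squared `H^{1/2}` norm. To control the error put `ρ = βg - w` and `τ = β Hu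
+ ψ / 2π`, so that `ρ = |D| τ` and `(ρ + w) / (βm) + 2πτ = c`. Pairing with the mean-zero functions
`ρ` and `w` removes `c`; positivity of `∫ ρ τ` and Cauchy–Schwarz-type inequalities then bound `|β
σ² - ‖ψ‖²|` by `2 ∫ w² / (β min m)`. This is `energy_estimate`. The potential enters only through
`min m`, which is why the same argument serves both scalings.

The rest justifies this computation. `isRegular_of_iInf_pos` shows that a positive infimum excludes
the default values in the definitions and, through the Euler–Lagrange equation (`euler_lagrange`),
that `log m` lies in `H¹`; hence so do `m` and `1 / m`. `HasL2Deriv.hasSum_hilbert` identifies the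
pointwise principal value with its Fourier series for `H¹` functions. `IsRegular.exists_isInvL`
produces a preimage under `𝓛` by coercivity. The estimate holds for every preimage and every
minimizer, so it does not matter which ones are selected. -/

/-- The Fourier coefficients of a real function on the torus. -/
def realCoeff (f : Torus → ℝ) (k : ℤ) : ℂ := fourierCoeff (fun x : Torus => (f x : ℂ)) k

theorem ae_haar_iff_ae_volume {p : Torus → Prop} :
    (∀ᵐ x ∂(haarAddCircle : Measure Torus), p x) ↔ ∀ᵐ x : Torus, p x := by
  rw [volume_eq_smul_haarAddCircle, Measure.ae_ennreal_smul_measure_iff]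
  simp [Real.pi_pos]

theorem integral_haar (F : Torus → ℂ) :
    ∫ x, F x ∂(haarAddCircle : Measure Torus) = ((2 * π : ℝ) : ℂ)⁻¹ * ∫ x, F x := by
  rw [integral_haarAddCircle, Complex.real_smul]; push_cast; rfl

theorem fourierCoeff_eq_integral_volume (F : Torus → ℂ) (k : ℤ) :
    fourierCoeff F k = ((2 * π : ℝ) : ℂ)⁻¹ * ∫ x, fourier (-k) x * F x := by
  rw [← integral_haar]; rfl

theorem realCoeff_eq_integral (f : Torus → ℝ) (k : ℤ) :
    realCoeff f k = ((2 * π : ℝ) : ℂ)⁻¹ * ∫ x, fourier (-k) x * (f x : ℂ) :=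
  fourierCoeff_eq_integral_volume _ k

theorem realCoeff_congr {f g : Torus → ℝ} (h : f =ᵐ[volume] g) (k : ℤ) :
    realCoeff f k = realCoeff g k := by
  simp only [realCoeff_eq_integral]
  congr 1
  apply integral_congr_ae
  filter_upwards [h] with x hx
  rw [hx]

theorem realCoeff_neg (f : Torus → ℝ) (k : ℤ) : realCoeff f (-k) = conj (realCoeff f k) := by
  simp only [realCoeff_eq_integral, map_mul, ← integral_conj]
  congr 1
  · rw [map_inv₀, Complex.conj_ofReal]
  · congr 1; funext x; simp

theorem memLp_ofReal {f : Torus → ℝ} (hf : MemLp f 2 volume) :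
    MemLp (fun x => (f x : ℂ)) 2 (haarAddCircle : Measure Torus) :=
  memLp_haarAddCircle_iff.2 hf.ofReal

theorem integrable_of_memLp_two {f : Torus → ℝ} (hf : MemLp f 2 volume) : Integrable f :=
  hf.integrable (by norm_num)

theorem norm_fourier_apply (k : ℤ) (x : Torus) : ‖fourier k x‖ = 1 := by
  rw [fourier_apply]; exact Circle.norm_coe _

theorem integrable_ofReal {f : Torus → ℝ} (hf : Integrable f) :
    Integrable fun x => (f x : ℂ) := hf.ofReal

theorem integrable_fourier_mul {F : Torus → ℂ} (hF : Integrable F) (k : ℤ) :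
    Integrable fun x => fourier k x * F x := by
  refine hF.bdd_mul (c := 1) (fourier k).continuous.aestronglyMeasurable ?_
  exact ae_of_all _ fun x => (norm_fourier_apply k x).le

theorem realCoeff_add {f g : Torus → ℝ} (hf : Integrable f) (hg : Integrable g) (k : ℤ) :
    realCoeff (fun x => f x + g x) k = realCoeff f k + realCoeff g k := by
  simp only [realCoeff_eq_integral, ← mul_add]
  rw [← integral_add (integrable_fourier_mul (integrable_ofReal hf) _)
    (integrable_fourier_mul (integrable_ofReal hg) _)]
  simp [mul_add]

theorem realCoeff_const_mul (c : ℝ) (f : Torus → ℝ) (k : ℤ) :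
    realCoeff (fun x => c * f x) k = c * realCoeff f k := by
  simp only [realCoeff_eq_integral]
  rw [mul_left_comm]
  congr 1
  rw [← integral_const_mul]
  congr 1; funext x; push_cast; ring

theorem realCoeff_zero_index (f : Torus → ℝ) :
    realCoeff f 0 = (((2 * π)⁻¹ * ∫ x, f x : ℝ) : ℂ) := by
  rw [realCoeff_eq_integral]
  simp [← integral_complex_ofReal]

theorem realCoeff_const {k : ℤ} (hk : k ≠ 0) (c : ℝ) : realCoeff (fun _ => c) k = 0 := by
  have h := congrFun (fourierCoeff_fourier (T := 2 * π) 0) k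
  rw [Pi.single_eq_of_ne hk] at h
  have : (fun _ : Torus => (c : ℂ)) = fun x => (c : ℂ) * fourier 0 x := by funext x; simp
  rw [realCoeff, this, fourierCoeff.const_mul, h, mul_zero]

theorem hasSum_fourierCoeff_inner {F G : Torus → ℂ} (hF : MemLp F 2 haarAddCircle)
    (hG : MemLp G 2 haarAddCircle) :
    HasSum (fun k => conj (fourierCoeff F k) * fourierCoeff G k)
      (∫ x, conj (F x) * G x ∂(haarAddCircle : Measure Torus)) := by
  have h := (fourierBasis (T := 2 * π)).hasSum_inner_mul_inner hF.toLp hG.toLp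
  have key : ∀ {H : Torus → ℂ} (hH : MemLp H 2 haarAddCircle) (k : ℤ),
      inner ℂ (fourierBasis (T := 2 * π) k) hH.toLp = fourierCoeff H k := by
    intro H hH k
    rw [← HilbertBasis.repr_apply_apply, fourierBasis_repr, fourierCoeff_congr_ae hH.coeFn_toLp]
  have e : inner ℂ hF.toLp hG.toLp = ∫ x, conj (F x) * G x ∂(haarAddCircle : Measure Torus) := by
    rw [L2.inner_def]
    apply integral_congr_ae
    filter_upwards [hF.coeFn_toLp, hG.coeFn_toLp] with x h1 h2
    rw [h1, h2, RCLike.inner_apply, mul_comm]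
  rw [e] at h
  refine h.congr_fun fun k => ?_
  rw [key hG, ← key hF, inner_conj_symm]

theorem exists_memLp_fourierCoeff {a : ℤ → ℂ} (ha : Summable fun k => ‖a k‖ ^ 2) :
    ∃ F : Torus → ℂ, MemLp F 2 haarAddCircle ∧ ∀ k, fourierCoeff F k = a k := by
  have hm : Memℓp a 2 := by
    apply memℓp_gen
    simpa using ha
  refine ⟨(fourierBasis (T := 2 * π)).repr.symm ⟨a, hm⟩, Lp.memLp _, fun k => ?_⟩
  rw [← fourierBasis_repr]
  simp

theorem realCoeff_re {F : Torus → ℂ} (hF : Integrable F) (k : ℤ) :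
    realCoeff (fun x => (F x).re) k = (fourierCoeff F k + conj (fourierCoeff F (-k))) / 2 := by
  have h1 : conj (fourierCoeff F (-k))
      = ((2 * π : ℝ) : ℂ)⁻¹ * ∫ x, fourier (-k) x * conj (F x) := by
    rw [fourierCoeff_eq_integral_volume, map_mul, ← integral_conj]
    congr 1
    · rw [map_inv₀, Complex.conj_ofReal]
    · congr 1; funext x; simp
  have hc : Integrable fun x => conj (F x) :=
    (Complex.conjCLE.toContinuousLinearMap.integrable_comp hF :)
  rw [h1, fourierCoeff_eq_integral_volume, ← mul_add,
    ← integral_add (integrable_fourier_mul hF _) (integrable_fourier_mul hc _),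
    realCoeff_eq_integral, mul_div_assoc, ← integral_div]
  congr 2; funext x
  rw [← mul_add, Complex.add_conj]
  push_cast; ring

/-- Riesz–Fischer for real functions. -/
theorem exists_memLp_realCoeff {a : ℤ → ℂ} (ha : Summable fun k => ‖a k‖ ^ 2)
    (hc : ∀ k, a (-k) = conj (a k)) :
    ∃ f : Torus → ℝ, MemLp f 2 volume ∧ ∀ k, realCoeff f k = a k := by
  obtain ⟨F, hF, h⟩ := exists_memLp_fourierCoeff ha
  have hF' := memLp_haarAddCircle_iff.1 hF
  refine ⟨fun x => (F x).re, hF'.re, fun k => ?_⟩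
  rw [realCoeff_re (hF'.integrable (by norm_num)), h, h, hc]
  simp

/-- Parseval's identity for real functions. -/
theorem hasSum_realCoeff_mul_conj {f g : Torus → ℝ} (hf : MemLp f 2 volume)
    (hg : MemLp g 2 volume) :
    HasSum (fun k => realCoeff f k * conj (realCoeff g k))
      (((2 * π)⁻¹ * ∫ x, f x * g x : ℝ) : ℂ) := by
  have h := hasSum_fourierCoeff_inner (memLp_ofReal hg) (memLp_ofReal hf)
  rw [integral_haar] at h
  convert h using 1
  · funext k; rw [mul_comm]; rfl
  · push_cast
    rw [← integral_complex_ofReal]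
    congr 2; funext x; simp [mul_comm]

theorem hasSum_norm_sq_realCoeff {f : Torus → ℝ} (hf : MemLp f 2 volume) :
    HasSum (fun k => ‖realCoeff f k‖ ^ 2) ((2 * π)⁻¹ * ∫ x, f x ^ 2) := by
  have h := hasSum_realCoeff_mul_conj hf hf
  rw [← Complex.hasSum_ofReal]
  convert h using 1
  · funext k; rw [Complex.mul_conj, Complex.normSq_eq_norm_sq]
  · simp [sq]

theorem ae_eq_of_realCoeff_eq {f g : Torus → ℝ} (hf : MemLp f 2 volume) (hg : MemLp g 2 volume)
    (h : ∀ k, realCoeff f k = realCoeff g k) : f =ᵐ[volume] g := by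
  have hd : MemLp (fun x => f x - g x) 2 volume := hf.sub hg
  have h0 : ∀ k, realCoeff (fun x => f x - g x) k = 0 := fun k => by
    have := realCoeff_add (f := fun x => f x - g x) (g := g) (integrable_of_memLp_two hd)
      (integrable_of_memLp_two hg) k
    simp only [sub_add_cancel] at this
    rw [h] at this
    simpa using this.symm
  have h1 := hasSum_norm_sq_realCoeff hd
  simp only [h0, norm_zero, ne_eq, OfNat.ofNat_ne_zero, not_false_eq_true, zero_pow] at h1
  have h2 := h1.unique hasSum_zero
  have h3 : ∫ x, (f x - g x) ^ 2 = 0 := by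
    rcases mul_eq_zero.1 h2 with h | h
    · exact absurd h (inv_ne_zero Real.two_pi_pos.ne')
    · exact h
  rw [integral_eq_zero_iff_of_nonneg (fun x => sq_nonneg _) hd.integrable_sq] at h3
  filter_upwards [h3] with x hx
  have : (f x - g x) ^ 2 = 0 := hx
  linarith [pow_eq_zero_iff (two_ne_zero) |>.1 this]

/-! ### Weak derivatives and Fourier coefficients -/

theorem continuous_of_continuous_coe {X : Type*} [TopologicalSpace X] {f : Torus → X}
    (h : Continuous fun t : ℝ => f (t : Torus)) : Continuous f :=
  (QuotientAddGroup.isQuotientMap_mk (N := AddSubgroup.zmultiples (2 * π))).continuous_iff.2 h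

theorem integrable_of_continuous {E : Type*} [NormedAddCommGroup E] {f : Torus → E}
    (h : Continuous f) : Integrable f :=
  h.integrable_of_hasCompactSupport (HasCompactSupport.of_compactSpace f)

theorem memLp_of_continuous {f : Torus → ℝ} (h : Continuous f) (p : ℝ≥0∞) : MemLp f p volume :=
  h.memLp_of_hasCompactSupport (HasCompactSupport.of_compactSpace f)

theorem hasDerivAt_fourier_two_pi (k : ℤ) (t : ℝ) :
    HasDerivAt (fun s : ℝ => fourier k (s : Torus)) (Complex.I * k * fourier k (t : Torus)) t := by
  convert hasDerivAt_fourier (2 * π) k t using 2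
  have : (π : ℂ) ≠ 0 := by exact_mod_cast Real.pi_ne_zero
  push_cast
  field_simp

/-- Integration by parts: the derivative of the periodic function `e^{-ikt} F(t)` integrates to zero
over one period. -/
theorem fourierCoeff_of_hasDerivAt {F F' : Torus → ℂ}
    (hF : ∀ t : ℝ, HasDerivAt (fun s : ℝ => F (s : Torus)) (F' (t : Torus)) t)
    (hF' : Continuous F') (k : ℤ) : fourierCoeff F' k = Complex.I * k * fourierCoeff F k := by
  have hc : Continuous F :=
    continuous_of_continuous_coe (continuous_iff_continuousAt.2 fun t => (hF t).continuousAt)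
  have hd : ∀ t : ℝ, HasDerivAt (fun s : ℝ => fourier (-k) (s : Torus) * F (s : Torus))
      ((fun x : Torus =>
        Complex.I * (-k : ℤ) * fourier (-k) x * F x + fourier (-k) x * F' x) t) t :=
    fun t => (hasDerivAt_fourier_two_pi (-k) t).mul (hF t)
  have hcont : Continuous fun x : Torus =>
      Complex.I * (-k : ℤ) * fourier (-k) x * F x + fourier (-k) x * F' x := by fun_prop
  have h0 := intervalIntegral.integral_eq_sub_of_hasDerivAt (a := 0) (b := 0 + 2 * π)
    (fun t _ => hd t) ((hcont.comp (AddCircle.continuous_mk' _)).intervalIntegrable _ _)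
  rw [AddCircle.intervalIntegral_preimage (2 * π) 0 (fun x : Torus =>
      Complex.I * (-k : ℤ) * fourier (-k) x * F x + fourier (-k) x * F' x)] at h0
  have hp : ((0 + 2 * π : ℝ) : Torus) = ((0 : ℝ) : Torus) := by
    rw [zero_add, AddCircle.coe_period]; rfl
  rw [hp, sub_self, integral_add (integrable_of_continuous (by fun_prop))
    (integrable_of_continuous (by fun_prop))] at h0
  simp only [mul_assoc (Complex.I * (-k : ℤ))] at h0
  rw [integral_const_mul] at h0
  rw [fourierCoeff_eq_integral_volume, fourierCoeff_eq_integral_volume]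
  push_cast at h0 ⊢
  linear_combination ((2 * (π : ℂ))⁻¹) * h0

theorem realCoeff_torusDeriv {f : Torus → ℝ} (hf : Differentiable ℝ (periodize f))
    (hc : Continuous (torusDeriv f)) (k : ℤ) :
    realCoeff (torusDeriv f) k = Complex.I * k * realCoeff f k := by
  refine fourierCoeff_of_hasDerivAt (F := fun x => (f x : ℂ)) (fun t => ?_) (by fun_prop) k
  exact (hf t).hasDerivAt.ofReal_comp

theorem contDiff_fourier_coe (k : ℤ) : ContDiff ℝ ∞ fun t : ℝ => fourier k (t : Torus) := by
  simp_rw [fourier_coe_apply]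
  have : ContDiff ℝ ∞ fun t : ℝ => (t : ℂ) := Complex.ofRealCLM.contDiff
  fun_prop

/-- An `L²` weak derivative has Fourier coefficients `i k f̂_k`. -/
theorem HasWeakDeriv.realCoeff_eq {f g : Torus → ℝ} (h : HasWeakDeriv f g)
    (hf : Integrable f) (hg : Integrable g) (k : ℤ) :
    realCoeff g k = Complex.I * k * realCoeff f k := by
  have hre : ∀ t : ℝ, HasDerivAt (fun s : ℝ => (fourier (-k) (s : Torus)).re)
      (Complex.I * (-k : ℤ) * fourier (-k) (t : Torus)).re t := fun t =>
    Complex.reCLM.hasFDerivAt.comp_hasDerivAt t (hasDerivAt_fourier_two_pi (-k) t)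
  have him : ∀ t : ℝ, HasDerivAt (fun s : ℝ => (fourier (-k) (s : Torus)).im)
      (Complex.I * (-k : ℤ) * fourier (-k) (t : Torus)).im t := fun t =>
    Complex.imCLM.hasFDerivAt.comp_hasDerivAt t (hasDerivAt_fourier_two_pi (-k) t)
  -- Test functions are real, so the exponential is tested through its real and imaginary parts,
  -- which are recombined in `key`.
  have h1 := h (fun x => (fourier (-k) x).re)
    (Complex.reCLM.contDiff.comp (contDiff_fourier_coe (-k)))
  have h2 := h (fun x => (fourier (-k) x).im)
    (Complex.imCLM.contDiff.comp (contDiff_fourier_coe (-k)))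
  have e1 : torusDeriv (fun x => (fourier (-k) x).re) =
      fun x => (Complex.I * (-k : ℤ) * fourier (-k) x).re := by
    funext x
    induction x using QuotientAddGroup.induction_on with
    | H t => exact (hre t).deriv
  have e2 : torusDeriv (fun x => (fourier (-k) x).im) =
      fun x => (Complex.I * (-k : ℤ) * fourier (-k) x).im := by
    funext x
    induction x using QuotientAddGroup.induction_on with
    | H t => exact (him t).deriv
  rw [e1] at h1
  rw [e2] at h2
  have key : ∀ {u : Torus → ℝ} (_ : Integrable u) (c : ℂ),
      ∫ x, (c * fourier (-k) x) * (u x : ℂ) =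
        ((∫ x, u x * (c * fourier (-k) x).re : ℝ) : ℂ)
          + ((∫ x, u x * (c * fourier (-k) x).im : ℝ) : ℂ) * Complex.I := by
    intro u hu c
    have hi : Integrable fun x => (c * fourier (-k) x) * (u x : ℂ) := by
      simp only [mul_assoc]
      exact (integrable_fourier_mul (integrable_ofReal hu) _).const_mul c
    rw [← integral_re_add_im hi]
    simp only [Complex.coe_algebraMap, RCLike.re_to_complex, RCLike.im_to_complex,
      Complex.re_mul_ofReal, Complex.im_mul_ofReal, RCLike.I_to_complex]
    simp only [mul_comm (u _)]
  have k1 := key hf (Complex.I * (-k : ℤ))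
  have k2 := key hg 1
  simp only [one_mul] at k2
  rw [h1, h2] at k1
  simp only [mul_assoc (Complex.I * (-k : ℤ))] at k1
  rw [integral_const_mul] at k1
  rw [realCoeff_eq_integral, realCoeff_eq_integral, k2]
  push_cast at k1 ⊢
  linear_combination ((2 * (π : ℂ))⁻¹) * k1

theorem continuous_torusDeriv {η : Torus → ℝ} (hη : ContDiff ℝ ∞ (periodize η)) :
    Continuous (torusDeriv η) :=
  continuous_of_continuous_coe (hη.continuous_deriv (by simp))

/-- An `L²` function whose Fourier coefficients are `i k f̂_k` is a weak derivative. -/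
theorem hasWeakDeriv_of_realCoeff {f g : Torus → ℝ} (hf : MemLp f 2 volume)
    (hg : MemLp g 2 volume) (h : ∀ k : ℤ, realCoeff g k = Complex.I * k * realCoeff f k) :
    HasWeakDeriv f g := by
  intro η hη
  have hηc : Continuous η := continuous_of_continuous_coe hη.continuous
  have hη' := continuous_torusDeriv hη
  have s1 := hasSum_realCoeff_mul_conj hf (memLp_of_continuous hη' 2)
  have s2 := (hasSum_realCoeff_mul_conj hg (memLp_of_continuous hηc 2)).neg
  have e : (fun k => realCoeff f k * conj (realCoeff (torusDeriv η) k)) =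
      fun k => -(realCoeff g k * conj (realCoeff η k)) := by
    funext k
    rw [h, realCoeff_torusDeriv (hη.differentiable (by simp)) hη']
    simp
    ring
  rw [e] at s1
  have := s1.unique s2
  rw [← Complex.ofReal_neg, Complex.ofReal_inj, ← mul_neg] at this
  exact mul_left_cancel₀ (inv_ne_zero Real.two_pi_pos.ne') this

/-- `g` is the `L²` derivative of the `L²` function `f`. -/
structure HasL2Deriv (f g : Torus → ℝ) : Prop where
  memLp : MemLp f 2 volume
  memLp_deriv : MemLp g 2 volume
  coeff : ∀ k : ℤ, realCoeff g k = Complex.I * k * realCoeff f k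

theorem HasL2Deriv.hasWeakDeriv {f g : Torus → ℝ} (h : HasL2Deriv f g) : HasWeakDeriv f g :=
  hasWeakDeriv_of_realCoeff h.memLp h.memLp_deriv h.coeff

theorem HasWeakDeriv.hasL2Deriv {f g : Torus → ℝ} (h : HasWeakDeriv f g)
    (hf : MemLp f 2 volume) (hg : MemLp g 2 volume) : HasL2Deriv f g :=
  ⟨hf, hg, h.realCoeff_eq (integrable_of_memLp_two hf) (integrable_of_memLp_two hg)⟩

theorem HasL2Deriv.ae_unique {f g g' : Torus → ℝ} (h : HasL2Deriv f g) (h' : HasL2Deriv f g') :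
    g =ᵐ[volume] g' :=
  ae_eq_of_realCoeff_eq h.memLp_deriv h'.memLp_deriv fun k => by rw [h.coeff, h'.coeff]

theorem HasL2Deriv.congr {f f' g g' : Torus → ℝ} (h : HasL2Deriv f g) (hf : f =ᵐ[volume] f')
    (hg : g =ᵐ[volume] g') : HasL2Deriv f' g' :=
  ⟨h.memLp.ae_eq hf, h.memLp_deriv.ae_eq hg, fun k => by
    rw [← realCoeff_congr hf, ← realCoeff_congr hg, h.coeff]⟩

theorem HasL2Deriv.weakDeriv {f g : Torus → ℝ} (h : HasL2Deriv f g) :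
    HasL2Deriv f (weakDeriv f) := by
  have hex : ∃ g, MemLp g 2 volume ∧ HasWeakDeriv f g := ⟨g, h.memLp_deriv, h.hasWeakDeriv⟩
  rw [TorusGas.weakDeriv, dif_pos hex]
  exact hex.choose_spec.2.hasL2Deriv h.memLp hex.choose_spec.1

theorem HasL2Deriv.weakDeriv_ae_eq {f g : Torus → ℝ} (h : HasL2Deriv f g) :
    TorusGas.weakDeriv f =ᵐ[volume] g :=
  h.weakDeriv.ae_unique h

theorem memH_one_iff {f : Torus → ℝ} : MemH 1 f ↔ ∃ g, HasL2Deriv f g :=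
  ⟨fun ⟨hf, g, hg, hg2⟩ => ⟨g, hg.hasL2Deriv hf hg2⟩,
    fun ⟨g, h⟩ => ⟨h.memLp, g, h.hasWeakDeriv, h.memLp_deriv⟩⟩

theorem memH_two_iff {f : Torus → ℝ} : MemH 2 f ↔ ∃ p q, HasL2Deriv f p ∧ HasL2Deriv p q :=
  ⟨fun ⟨hf, p, hp, hp1⟩ => by
      obtain ⟨q, hq⟩ := memH_one_iff.1 hp1
      exact ⟨p, q, hp.hasL2Deriv hf hq.memLp, hq⟩,
    fun ⟨p, q, hp, hq⟩ => ⟨hp.memLp, p, hp.hasWeakDeriv, memH_one_iff.2 ⟨q, hq⟩⟩⟩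

theorem HasL2Deriv.add {f g f' g' : Torus → ℝ} (h : HasL2Deriv f f') (h' : HasL2Deriv g g') :
    HasL2Deriv (fun x => f x + g x) (fun x => f' x + g' x) :=
  ⟨h.memLp.add h'.memLp, h.memLp_deriv.add h'.memLp_deriv, fun k => by
    rw [realCoeff_add (integrable_of_memLp_two h.memLp) (integrable_of_memLp_two h'.memLp),
      realCoeff_add (integrable_of_memLp_two h.memLp_deriv)
        (integrable_of_memLp_two h'.memLp_deriv),
      h.coeff, h'.coeff, mul_add]⟩

theorem hasL2Deriv_const (c : ℝ) : HasL2Deriv (fun _ => c) (fun _ => 0) :=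
  ⟨memLp_const c, memLp_const 0, fun k => by
    by_cases hk : k = 0
    · subst hk; simp [realCoeff_zero_index]
    · simp [realCoeff_const hk]⟩

/-- The antiderivative of a mean-zero `L²` function. -/
theorem exists_hasL2Deriv {g : Torus → ℝ} (hg : MemLp g 2 volume) (h0 : ∫ x, g x = 0) :
    ∃ f, HasL2Deriv f g := by
  have hs := (hasSum_norm_sq_realCoeff hg).summable
  -- At `k = 0` the inverse is `0`, which selects the mean-zero antiderivative; the condition on `∫
  -- g` is what makes the zeroth coefficients agree.
  obtain ⟨f, hf, hfc⟩ := exists_memLp_realCoeff (a := fun k => (Complex.I * k)⁻¹ * realCoeff g k)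
    (hs.of_nonneg_of_le (fun k => by positivity) fun k => by
      rw [norm_mul, mul_pow]
      refine mul_le_of_le_one_left (by positivity) ?_
      rw [norm_inv, norm_mul, Complex.norm_I, one_mul, Complex.norm_intCast]
      by_cases hk : k = 0
      · simp [hk]
      · have : (1 : ℝ) ≤ |(k : ℝ)| := by exact_mod_cast Int.one_le_abs hk
        exact pow_le_one₀ (by positivity) (inv_le_one_of_one_le₀ this))
    (fun k => by simp [realCoeff_neg])
  refine ⟨f, hf, hg, fun k => ?_⟩
  by_cases hk : k = 0
  · subst hk; simp [realCoeff_zero_index, h0]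
  · have : (k : ℂ) ≠ 0 := by exact_mod_cast hk
    rw [hfc, mul_inv_cancel_left₀ (mul_ne_zero Complex.I_ne_zero this)]

/-! ### Absolutely convergent Fourier series of `H¹` functions -/

/-- Factor the term as `(|k| |f̂_k|) · |k|^{-3/4}` and bound the product by the sum of squares;
`|k|^{-3/2}` is summable. The spare power `1/4` pays for the growth in `k` of the truncated
cotangent integrals. -/
theorem HasL2Deriv.summable_rpow_mul_norm {f g : Torus → ℝ} (h : HasL2Deriv f g) :
    Summable fun k : ℤ => |(k : ℝ)| ^ (1 / 4 : ℝ) * ‖realCoeff f k‖ := by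
  have h1 := (hasSum_norm_sq_realCoeff h.memLp_deriv).summable
  have h2 : Summable fun k : ℤ => |(k : ℝ)| ^ (-(3 / 2) : ℝ) :=
    Real.summable_abs_int_rpow (by norm_num)
  refine (h1.add h2).of_nonneg_of_le (fun k => by positivity) fun k => ?_
  by_cases hk : k = 0
  · subst hk
    simp only [Int.cast_zero, abs_zero]
    rw [Real.zero_rpow (by norm_num), Real.zero_rpow (by norm_num)]
    simp
  · have hk' : 0 < |(k : ℝ)| := by positivity
    have e1 : |(k : ℝ)| ^ (-(3 / 2) : ℝ) = (|(k : ℝ)| ^ (-(3 / 4) : ℝ)) ^ 2 := by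
      rw [← Real.rpow_natCast, ← Real.rpow_mul hk'.le]; norm_num
    have e2 : |(k : ℝ)| ^ (1 / 4 : ℝ) = |(k : ℝ)| * |(k : ℝ)| ^ (-(3 / 4) : ℝ) := by
      rw [← Real.rpow_one_add' hk'.le (by norm_num)]; norm_num
    rw [h.coeff, norm_mul, norm_mul, Complex.norm_I, one_mul, Complex.norm_intCast, e1, e2]
    nlinarith [sq_nonneg (|(k : ℝ)| * ‖realCoeff f k‖ - |(k : ℝ)| ^ (-(3 / 4) : ℝ)),
      sq_nonneg (|(k : ℝ)| * ‖realCoeff f k‖), sq_nonneg (|(k : ℝ)| ^ (-(3 / 4) : ℝ))]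

theorem HasL2Deriv.summable_norm {f g : Torus → ℝ} (h : HasL2Deriv f g) :
    Summable fun k : ℤ => ‖realCoeff f k‖ := by
  refine (h.summable_rpow_mul_norm.of_norm_bounded_eventually (f := fun k => ‖realCoeff f k‖) ?_)
  rw [Filter.eventually_cofinite]
  refine (Set.finite_singleton (0 : ℤ)).subset fun k hk => ?_
  by_contra hk0
  apply hk
  have h1 : (1 : ℝ) ≤ |(k : ℝ)| := by exact_mod_cast Int.one_le_abs hk0
  rw [norm_norm]
  exact le_mul_of_one_le_left (norm_nonneg _) (Real.one_le_rpow h1 (by norm_num))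

/-- A real `L²` function with summable Fourier coefficients is almost everywhere equal to the
continuous sum of its Fourier series. -/
theorem exists_continuous_hasSum {f : Torus → ℝ} (hf : MemLp f 2 volume)
    (h : Summable fun k : ℤ => ‖realCoeff f k‖) :
    ∃ F : Torus → ℝ, Continuous F ∧ f =ᵐ[volume] F ∧
      ∀ x, HasSum (fun k : ℤ => realCoeff f k * fourier k x) (F x : ℂ) := by
  have hs : Summable fun k : ℤ => realCoeff f k • (fourier k : C(Torus, ℂ)) := by
    apply Summable.of_norm
    simpa only [norm_smul, fourier_norm, mul_one] using h
  obtain ⟨G, hG⟩ := hs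
  have hfL := memLp_ofReal hf
  have h1 := hasSum_fourier_series_L2 hfL.toLp
  simp_rw [fourierCoeff_congr_ae hfL.coeFn_toLp] at h1
  have h2 := (ContinuousMap.toLp (E := ℂ) 2 (haarAddCircle : Measure Torus) ℂ).hasSum hG
  have h3 : ContinuousMap.toLp (E := ℂ) 2 (haarAddCircle : Measure Torus) ℂ G = hfL.toLp := by
    refine h2.unique ?_
    convert h1 using 1
    funext k
    simp [realCoeff, fourierLp]
  have h4 : ∀ᵐ x : Torus, G x = f x := by
    rw [← ae_haar_iff_ae_volume]
    filter_upwards [hfL.coeFn_toLp, ContinuousMap.coeFn_toLp (p := 2) (𝕜 := ℂ)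
      (haarAddCircle : Measure Torus) G] with x hx1 hx2
    rw [← hx1, ← h3, hx2]
  have him : (fun x => (G x).im) = fun _ => 0 := by
    refine Continuous.ae_eq_iff_eq (volume : Measure Torus) (by fun_prop) (by fun_prop) |>.1 ?_
    filter_upwards [h4] with x hx
    simp [hx]
  refine ⟨fun x => (G x).re, by fun_prop, ?_, fun x => ?_⟩
  · filter_upwards [h4] with x hx
    simp [hx]
  · have e : ((G x).re : ℂ) = G x := by
      apply Complex.ext
      · simp
      · simpa using (congrFun him x).symm
    rw [e]
    simpa using (ContinuousMap.evalCLM ℂ x).hasSum hG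

theorem HasL2Deriv.exists_continuous {f g : Torus → ℝ} (h : HasL2Deriv f g) :
    ∃ F : Torus → ℝ, Continuous F ∧ f =ᵐ[volume] F ∧
      ∀ x, HasSum (fun k : ℤ => realCoeff f k * fourier k x) (F x : ℂ) :=
  exists_continuous_hasSum h.memLp h.summable_norm

theorem HasL2Deriv.memLp_top {f g : Torus → ℝ} (h : HasL2Deriv f g) : MemLp f ∞ volume := by
  obtain ⟨F, hF, he, -⟩ := h.exists_continuous
  exact (memLp_of_continuous hF ∞).ae_eq he.symm

/-! ### Products and exponentials -/

theorem memLp_two_mul_top {f g : Torus → ℝ} (hf : MemLp f 2 volume) (hg : MemLp g ∞ volume) :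
    MemLp (fun x => f x * g x) 2 volume := hg.mul' hf

theorem hasSum_realCoeff_mul {f g : Torus → ℝ} (hf : MemLp f 2 volume) (hg : MemLp g 2 volume)
    (k : ℤ) : HasSum (fun j : ℤ => conj (realCoeff f j) * realCoeff g (j + k))
      (realCoeff (fun x => f x * g x) k) := by
  have hG : MemLp (fun x => fourier (-k) x * (g x : ℂ)) 2 (haarAddCircle : Measure Torus) := by
    refine (memLp_ofReal hg).of_le
      ((fourier (-k)).continuous.aestronglyMeasurable.mul (memLp_ofReal hg).1) ?_
    exact ae_of_all _ fun x => by rw [norm_mul, norm_fourier_apply, one_mul]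
  have h := hasSum_fourierCoeff_inner (memLp_ofReal hf) hG
  convert h using 1
  · funext j
    congr 1
    simp only [realCoeff, fourierCoeff, smul_eq_mul, ← mul_assoc, ← fourier_add, neg_add]
  · simp only [realCoeff, fourierCoeff, smul_eq_mul]
    congr 1; funext x
    simp only [Complex.conj_ofReal]
    push_cast; ring

/-- Coefficients of a product are convolutions, and the Leibniz rule is the identity `(j + k) - j =
k` inside the convolution sum. -/
theorem HasL2Deriv.mul {f f' g g' : Torus → ℝ} (hf : HasL2Deriv f f') (hg : HasL2Deriv g g') :
    HasL2Deriv (fun x => f x * g x) (fun x => f' x * g x + g' x * f x) := by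
  have m1 := memLp_two_mul_top hf.memLp_deriv hg.memLp_top
  have m2 := memLp_two_mul_top hg.memLp_deriv hf.memLp_top
  refine ⟨memLp_two_mul_top hf.memLp hg.memLp_top, m1.add m2, fun k => ?_⟩
  rw [realCoeff_add (integrable_of_memLp_two m1) (integrable_of_memLp_two m2)]
  have s1 := hasSum_realCoeff_mul hf.memLp_deriv hg.memLp k
  have s2 := hasSum_realCoeff_mul hf.memLp hg.memLp_deriv k
  have s3 := (hasSum_realCoeff_mul hf.memLp hg.memLp k).mul_left (Complex.I * k)
  simp only [mul_comm (g' _)]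
  refine (s1.add s2).unique ?_
  refine s3.congr_fun fun j => ?_
  rw [hf.coeff, hg.coeff]
  simp
  ring

theorem HasL2Deriv.const_mul {f f' : Torus → ℝ} (c : ℝ) (hf : HasL2Deriv f f') :
    HasL2Deriv (fun x => c * f x) (fun x => c * f' x) :=
  ⟨hf.memLp.const_mul c, hf.memLp_deriv.const_mul c, fun k => by
    rw [realCoeff_const_mul, realCoeff_const_mul, hf.coeff]; ring⟩

theorem HasL2Deriv.pow_div_factorial {f f' : Torus → ℝ} (hf : HasL2Deriv f f') (n : ℕ) :
    HasL2Deriv (fun x => f x ^ (n + 1) / (n + 1).factorial)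
      (fun x => f x ^ n / n.factorial * f' x) := by
  induction n with
  | zero => simpa using hf
  | succ n ih =>
    refine ((ih.mul hf).const_mul ((n + 2 : ℝ)⁻¹)).congr (ae_of_all _ fun x => ?_)
      (ae_of_all _ fun x => ?_)
    · have : (n : ℝ) + 2 ≠ 0 := by positivity
      simp only [Nat.factorial_succ (n + 1)]
      push_cast
      field_simp
      ring
    · have h2 : (n : ℝ) + 2 ≠ 0 := by positivity
      have h1 : (n : ℝ) + 1 ≠ 0 := by positivity
      simp only [Nat.factorial_succ n]
      push_cast
      field_simp
      ring

theorem hasSum_realCoeff_of_bound {f : ℕ → Torus → ℝ} {F h : Torus → ℝ} {b : ℕ → ℝ}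
    (hf : ∀ n, AEStronglyMeasurable (f n) volume) (hb : Summable b) (hh : Integrable h)
    (hbound : ∀ n x, |f n x| ≤ b n * |h x|) (hF : ∀ x, HasSum (fun n => f n x) (F x)) (k : ℤ) :
    HasSum (fun n => realCoeff (f n) k) (realCoeff F k) := by
  simp only [realCoeff_eq_integral]
  refine HasSum.mul_left _ ?_
  refine hasSum_integral_of_dominated_convergence (fun n x => b n * |h x|) (fun n => ?_)
    (fun n => ae_of_all _ fun x => ?_) (ae_of_all _ fun x => hb.mul_right _) ?_
    (ae_of_all _ fun x => ?_)
  · exact (fourier (-k)).continuous.aestronglyMeasurable.mul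
      (Complex.continuous_ofReal.comp_aestronglyMeasurable (hf n))
  · rw [norm_mul, norm_fourier_apply, one_mul, Complex.norm_real]
    exact hbound n x
  · simp_rw [tsum_mul_right]
    exact hh.abs.const_mul _
  · exact ((Complex.hasSum_ofReal.2 (hF x))).mul_left _

/-- The chain rule is obtained term by term from the exponential series; since `l` is bounded by
some `M`, the Fourier coefficients may be taken under the sum with majorant `M^n / n!`. -/
theorem HasL2Deriv.exp {l l' : Torus → ℝ} (h : HasL2Deriv l l') (hl : Continuous l) :
    HasL2Deriv (fun x => Real.exp (l x)) (fun x => Real.exp (l x) * l' x) := by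
  have hc : Continuous fun x => Real.exp (l x) := by fun_prop
  have hm : MemLp (fun x => Real.exp (l x) * l' x) 2 volume := by
    simpa only [mul_comm] using memLp_two_mul_top h.memLp_deriv (memLp_of_continuous hc ∞)
  refine ⟨memLp_of_continuous hc 2, hm, fun k => ?_⟩
  obtain ⟨M, hM⟩ := (isCompact_range hl.norm).bddAbove
  have hM' : ∀ x, |l x| ≤ M := fun x => hM ⟨x, rfl⟩
  have hpow : ∀ n x, |l x ^ n / n.factorial| ≤ M ^ n / n.factorial := fun n x => by
    rw [abs_div, abs_pow, Nat.abs_cast]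
    gcongr
    exact hM' x
  have hexp : ∀ x, HasSum (fun n : ℕ => l x ^ n / n.factorial) (Real.exp (l x)) := fun x => by
    rw [Real.exp_eq_exp_ℝ]; exact NormedSpace.expSeries_div_hasSum_exp (l x)
  have s1 := hasSum_realCoeff_of_bound (f := fun n x => l x ^ n / n.factorial)
    (F := fun x => Real.exp (l x)) (h := fun _ => 1) (b := fun n => M ^ n / n.factorial)
    (fun n => by fun_prop) (Real.summable_pow_div_factorial M) (integrable_const 1)
    (fun n x => by simpa using hpow n x) hexp k
  have s2 := hasSum_realCoeff_of_bound (f := fun n x => l x ^ n / n.factorial * l' x)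
    (F := fun x => Real.exp (l x) * l' x) (h := l') (b := fun n => M ^ n / n.factorial)
    (fun n => ((by fun_prop : Continuous fun x => l x ^ n / n.factorial).aestronglyMeasurable).mul
      h.memLp_deriv.1) (Real.summable_pow_div_factorial M)
    (integrable_of_memLp_two h.memLp_deriv)
    (fun n x => by rw [abs_mul]; gcongr; exact hpow n x) (fun x => (hexp x).mul_right _) k
  refine s2.unique ?_
  -- The term `n = 0` is a constant and is annihilated by `i k`; removing it aligns the two series,
  -- the derivative of term `n + 1` being term `n` times `l'`.
  have s3 := (hasSum_nat_add_iff' 1).2 (s1.mul_left (Complex.I * k))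
  have hz : Complex.I * k * realCoeff (fun x => l x ^ 0 / (Nat.factorial 0 : ℝ)) k = 0 := by
    by_cases hk : k = 0
    · simp [hk]
    · simp [realCoeff_const hk]
  simp only [Finset.range_one, Finset.sum_singleton] at s3
  rw [hz, sub_zero] at s3
  exact s3.congr_fun fun n => (h.pow_div_factorial n).coeff k

/-! ### The kernels `cot (x / 2)` and `|sin (x / 2)|` -/

theorem absSinHalf_coe (t : ℝ) : absSinHalf (t : Torus) = |Real.sin (t / 2)| := rfl

theorem invTanHalf_coe (t : ℝ) : invTanHalf (t : Torus) = (Real.tan (t / 2))⁻¹ := rfl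

theorem fourier_coe_two_pi (k : ℤ) (t : ℝ) :
    fourier k (t : Torus) = Complex.exp (k * t * Complex.I) := by
  rw [fourier_coe_apply]
  congr 1
  have : (π : ℂ) ≠ 0 := by exact_mod_cast Real.pi_ne_zero
  push_cast
  field_simp

theorem fourier_one_sub_one_coe (t : ℝ) : fourier 1 (t : Torus) - 1 =
    Complex.exp ((t / 2 : ℝ) * Complex.I) * (2 * Complex.I * (Real.sin (t / 2) : ℂ)) := by
  have e : Complex.exp ((1 : ℤ) * t * Complex.I) = Complex.exp ((t / 2 : ℝ) * Complex.I)
      * Complex.exp ((t / 2 : ℝ) * Complex.I) := by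
    rw [← Complex.exp_add]; congr 1; push_cast; ring
  have h1 := Complex.sin_sq_add_cos_sq ((t / 2 : ℝ) : ℂ)
  have hI := Complex.I_sq
  rw [fourier_coe_two_pi, e, Complex.exp_mul_I, Complex.ofReal_sin]
  linear_combination h1 + (-Complex.sin ((t / 2 : ℝ) : ℂ) ^ 2) * hI

theorem fourier_one_add_one_coe (t : ℝ) : fourier 1 (t : Torus) + 1 =
    Complex.exp ((t / 2 : ℝ) * Complex.I) * (2 * (Real.cos (t / 2) : ℂ)) := by
  have e : Complex.exp ((1 : ℤ) * t * Complex.I) = Complex.exp ((t / 2 : ℝ) * Complex.I)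
      * Complex.exp ((t / 2 : ℝ) * Complex.I) := by
    rw [← Complex.exp_add]; congr 1; push_cast; ring
  have h1 := Complex.sin_sq_add_cos_sq ((t / 2 : ℝ) : ℂ)
  have hI := Complex.I_sq
  rw [fourier_coe_two_pi, e, Complex.exp_mul_I, Complex.ofReal_cos]
  linear_combination (-1) * h1 + (Complex.sin ((t / 2 : ℝ) : ℂ) ^ 2) * hI

theorem norm_fourier_one_sub_one (x : Torus) : ‖fourier 1 x - 1‖ = 2 * absSinHalf x := by
  induction x using QuotientAddGroup.induction_on with
  | H t =>
    rw [fourier_one_sub_one_coe, norm_mul, Complex.norm_exp_ofReal_mul_I, one_mul, norm_mul,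
      norm_mul, Complex.norm_I, Complex.norm_real, absSinHalf_coe]
    simp

theorem absSinHalf_nonneg (x : Torus) : 0 ≤ absSinHalf x := by
  have := norm_nonneg (fourier 1 x - 1)
  rw [norm_fourier_one_sub_one] at this
  linarith

theorem absSinHalf_le_one (x : Torus) : absSinHalf x ≤ 1 := by
  have := norm_sub_le (fourier 1 x) 1
  rw [norm_fourier_one_sub_one, norm_fourier_apply, norm_one] at this
  linarith

theorem fourier_one_eq_one_iff {x : Torus} : fourier 1 x = 1 ↔ x = 0 := by
  constructor
  · intro h
    rw [fourier_one] at h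
    apply AddCircle.injective_toCircle (T := 2 * π) Real.two_pi_pos.ne'
    rw [AddCircle.toCircle_zero]
    exact Circle.ext (by simpa using h)
  · rintro rfl
    exact fourier_eval_zero 1

theorem absSinHalf_pos {x : Torus} (hx : x ≠ 0) : 0 < absSinHalf x := by
  have := norm_pos_iff.2 (sub_ne_zero.2 (mt fourier_one_eq_one_iff.1 hx))
  rw [norm_fourier_one_sub_one] at this
  linarith

theorem continuous_absSinHalf : Continuous absSinHalf := by
  have : absSinHalf = fun x => ‖fourier 1 x - 1‖ / 2 := by
    funext x; rw [norm_fourier_one_sub_one]; ring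
  rw [this]; fun_prop

theorem fourier_one_sub_one_mul_invTanHalf {x : Torus} (hx : x ≠ 0) :
    (fourier 1 x - 1) * (invTanHalf x : ℂ) = Complex.I * (fourier 1 x + 1) := by
  have hp := absSinHalf_pos hx
  induction x using QuotientAddGroup.induction_on with
  | H t =>
    have hs : Real.sin (t / 2) ≠ 0 := abs_pos.1 hp
    have hs' : ((Real.sin (t / 2) : ℝ) : ℂ) ≠ 0 := by exact_mod_cast hs
    rw [fourier_one_sub_one_coe, fourier_one_add_one_coe, invTanHalf_coe, Real.tan_eq_sin_div_cos,
      inv_div]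
    have h2 : ((Real.sin (t / 2) : ℝ) : ℂ) * ((Real.cos (t / 2) / Real.sin (t / 2) : ℝ) : ℂ)
        = (Real.cos (t / 2) : ℝ) := by
      rw [← Complex.ofReal_mul, mul_div_cancel₀ _ hs]
    linear_combination (Complex.exp ((t / 2 : ℝ) * Complex.I) * 2 * Complex.I) * h2

theorem invTanHalf_zero : invTanHalf 0 = 0 := by
  have := invTanHalf_coe 0
  simpa using this

theorem invTanHalf_eq_re (x : Torus) :
    invTanHalf x = (Complex.I * (fourier 1 x + 1) / (fourier 1 x - 1)).re := by
  by_cases hx : x = 0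
  · subst hx; rw [invTanHalf_zero, fourier_eval_zero]; simp
  · rw [← fourier_one_sub_one_mul_invTanHalf hx,
      mul_div_cancel_left₀ _ (sub_ne_zero.2 (mt fourier_one_eq_one_iff.1 hx)), Complex.ofReal_re]

theorem measurable_invTanHalf : Measurable invTanHalf := by
  have : invTanHalf = fun x => (Complex.I * (fourier 1 x + 1) / (fourier 1 x - 1)).re := by
    funext x; exact invTanHalf_eq_re x
  rw [this]
  have := (fourier (T := 2 * π) 1).continuous.measurable
  exact Complex.measurable_re.comp
    (((this.add_const 1).const_mul Complex.I).div (this.sub_const 1))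

theorem abs_invTanHalf_mul_le (x : Torus) : |invTanHalf x| * absSinHalf x ≤ 1 := by
  induction x using QuotientAddGroup.induction_on with
  | H t =>
    rw [invTanHalf_coe, absSinHalf_coe, ← abs_mul, Real.tan_eq_sin_div_cos, inv_div]
    by_cases hs : Real.sin (t / 2) = 0
    · simp [hs]
    · rw [div_mul_cancel₀ _ hs]; exact Real.abs_cos_le_one _

theorem invTanHalf_neg (x : Torus) : invTanHalf (-x) = -invTanHalf x := by
  induction x using QuotientAddGroup.induction_on with
  | H t =>
    have : -(t : Torus) = ((-t : ℝ) : Torus) := rfl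
    rw [invTanHalf_coe]
    erw [this, invTanHalf_coe]
    rw [neg_div, Real.tan_neg, inv_neg]

theorem absSinHalf_neg (x : Torus) : absSinHalf (-x) = absSinHalf x := by
  have h1 := norm_fourier_one_sub_one (-x)
  have h2 := norm_fourier_one_sub_one x
  have h3 : fourier 1 (-x) - 1 = conj (fourier 1 x - 1) := by
    rw [map_sub, map_one, ← fourier_neg, fourier_apply, fourier_apply]
    simp
  rw [h3, RCLike.norm_conj, h2] at h1
  linarith

theorem norm_fourier_sub_one_le (k : ℤ) (x : Torus) :
    ‖fourier k x - 1‖ ≤ |(k : ℝ)| * (2 * absSinHalf x) := by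
  have hnat : ∀ n : ℕ, ‖fourier (n : ℤ) x - 1‖ ≤ n * (2 * absSinHalf x) := by
    intro n
    induction n with
    | zero => simp
    | succ n ih =>
      have e : fourier ((n + 1 : ℕ) : ℤ) x - 1
          = (fourier (n : ℤ) x - 1) * fourier 1 x + (fourier 1 x - 1) := by
        push_cast; rw [fourier_add]; ring
      rw [e]
      refine (norm_add_le _ _).trans ?_
      rw [norm_mul, norm_fourier_apply, mul_one, norm_fourier_one_sub_one]
      push_cast
      linarith
  rcases Int.eq_nat_or_neg k with ⟨n, rfl | rfl⟩
  · simpa using hnat n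
  · have : fourier (-(n : ℤ)) x - 1 = conj (fourier (n : ℤ) x - 1) := by
      rw [map_sub, map_one, ← fourier_neg]
    rw [this, RCLike.norm_conj]
    simpa using hnat n

/-- Interpolation between the Lipschitz bound (for small `y`) and the trivial bound `2`. With
exponent `1/4`, multiplication by the cotangent leaves an integrable singularity of order `-3/4`. -/
theorem norm_fourier_sub_one_le_rpow (k : ℤ) (x : Torus) :
    ‖fourier k x - 1‖ ≤ 2 * (|(k : ℝ)| ^ (1 / 4 : ℝ) * (2 * absSinHalf x) ^ (1 / 4 : ℝ)) := by
  have hn := absSinHalf_nonneg x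
  rw [← Real.mul_rpow (abs_nonneg _) (by positivity)]
  set y := |(k : ℝ)| * (2 * absSinHalf x) with hy
  have hy0 : 0 ≤ y := by positivity
  rcases le_total y 1 with h | h
  · have h1 := norm_fourier_sub_one_le k x
    have h2 : y ≤ y ^ (1 / 4 : ℝ) := Real.self_le_rpow_of_le_one hy0 h (by norm_num)
    have h3 : 0 ≤ y ^ (1 / 4 : ℝ) := by positivity
    linarith
  · have h1 := norm_sub_le (fourier k x) 1
    rw [norm_fourier_apply, norm_one] at h1
    have h2 : 1 ≤ y ^ (1 / 4 : ℝ) := Real.one_le_rpow h (by norm_num)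
    linarith

/-- The function `(e^{-iks} - 1) cot (s / 2)`. -/
def cotDiff (k : ℤ) (x : Torus) : ℂ := (fourier (-k) x - 1) * (invTanHalf x : ℂ)

theorem measurable_cotDiff (k : ℤ) : Measurable (cotDiff k) :=
  ((fourier (-k)).continuous.measurable.sub_const 1).mul
    (Complex.measurable_ofReal.comp measurable_invTanHalf)

theorem norm_cotDiff_le (k : ℤ) (x : Torus) : ‖cotDiff k x‖ ≤ 2 * |(k : ℝ)| := by
  have h1 := norm_fourier_sub_one_le (-k) x
  have h2 := abs_invTanHalf_mul_le x
  push_cast at h1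
  rw [abs_neg] at h1
  rw [cotDiff, norm_mul, Complex.norm_real, Real.norm_eq_abs]
  calc _ ≤ |(k : ℝ)| * (2 * absSinHalf x) * |invTanHalf x| := by gcongr
    _ = 2 * |(k : ℝ)| * (|invTanHalf x| * absSinHalf x) := by ring
    _ ≤ 2 * |(k : ℝ)| * 1 := by gcongr
    _ = _ := mul_one _

theorem norm_cotDiff_le_rpow (k : ℤ) (x : Torus) :
    ‖cotDiff k x‖ ≤ |(k : ℝ)| ^ (1 / 4 : ℝ) * (4 * (2 * absSinHalf x) ^ (-(3 / 4) : ℝ)) := by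
  by_cases hx : x = 0
  · subst hx
    have := absSinHalf_nonneg 0
    rw [cotDiff, invTanHalf_zero]
    simp only [Complex.ofReal_zero, mul_zero, norm_zero]
    positivity
  have hp := absSinHalf_pos hx
  have h1 := norm_fourier_sub_one_le_rpow (-k) x
  have h2 : |invTanHalf x| ≤ 2 * (2 * absSinHalf x)⁻¹ := by
    have := abs_invTanHalf_mul_le x
    rw [mul_inv, mul_inv_cancel_left₀ two_ne_zero]
    exact (le_div_iff₀ hp).2 this |>.trans_eq (one_div _)
  have h3 : (2 * absSinHalf x) ^ (-(3 / 4) : ℝ)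
      = (2 * absSinHalf x) ^ (1 / 4 : ℝ) * (2 * absSinHalf x)⁻¹ := by
    rw [← Real.rpow_neg_one, ← Real.rpow_add (by positivity)]; norm_num
  push_cast at h1
  rw [abs_neg] at h1
  rw [cotDiff, norm_mul, Complex.norm_real, Real.norm_eq_abs, h3]
  calc _ ≤ 2 * (|(k : ℝ)| ^ (1 / 4 : ℝ) * (2 * absSinHalf x) ^ (1 / 4 : ℝ))
        * (2 * (2 * absSinHalf x)⁻¹) := by gcongr
    _ = _ := by ring

theorem integrable_iff_coe {E : Type*} [NormedAddCommGroup E] {f : Torus → E}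
    (hf : AEStronglyMeasurable f volume) (a : ℝ) :
    Integrable f ↔ IntegrableOn (fun t : ℝ => f (t : Torus)) (Set.Ioc a (a + 2 * π)) :=
  ((AddCircle.measurePreserving_mk (2 * π) a).integrable_comp hf).symm

theorem integrable_absSinHalf_rpow :
    Integrable fun x : Torus => (2 * absSinHalf x) ^ (-(3 / 4) : ℝ) := by
  have hm : Measurable fun x : Torus => (2 * absSinHalf x) ^ (-(3 / 4) : ℝ) :=
    (continuous_absSinHalf.measurable.const_mul 2).pow_const _
  rw [integrable_iff_coe hm.aestronglyMeasurable (-π)]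
  have e : -π + 2 * π = π := by ring
  rw [e]
  have hmr : Measurable fun t : ℝ => (2 * |Real.sin (t / 2)|) ^ (-(3 / 4) : ℝ) := by fun_prop
  have hpos : IntervalIntegrable (fun t : ℝ => (2 * |Real.sin (t / 2)|) ^ (-(3 / 4) : ℝ))
      volume 0 π := by
    have h1 : IntervalIntegrable (fun t : ℝ => (2 / π) ^ (-(3 / 4) : ℝ) * t ^ (-(3 / 4) : ℝ))
        volume 0 π :=
      (intervalIntegral.intervalIntegrable_rpow' (by norm_num)).const_mul _
    rw [intervalIntegrable_iff_integrableOn_Ioc_of_le Real.pi_pos.le] at h1 ⊢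
    refine h1.mono' hmr.aestronglyMeasurable ?_
    filter_upwards [ae_restrict_mem measurableSet_Ioc] with t ht
    -- Jordan's inequality reduces integrability to that of `t^{-3/4}` near zero.
    have h2 := Real.mul_le_sin (x := t / 2) (by linarith [ht.1]) (by linarith [ht.2])
    have h3 : 2 / π * t ≤ 2 * |Real.sin (t / 2)| := by
      linarith [le_abs_self (Real.sin (t / 2)), (by ring : 2 / π * (t / 2) * 2 = 2 / π * t)]
    have h4 : 0 < 2 / π * t := mul_pos (by positivity) ht.1
    rw [Real.norm_of_nonneg (by positivity), ← Real.mul_rpow (by positivity) ht.1.le]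
    exact Real.rpow_le_rpow_of_nonpos h4 h3 (by norm_num)
  have hneg : IntervalIntegrable (fun t : ℝ => (2 * |Real.sin (t / 2)|) ^ (-(3 / 4) : ℝ))
      volume (-π) 0 := by
    rw [IntervalIntegrable.iff_comp_neg]
    simpa [neg_div] using hpos.symm
  exact (intervalIntegrable_iff_integrableOn_Ioc_of_le (by linarith [Real.pi_pos])).1
    (hneg.trans hpos)

theorem integrable_cotDiff (k : ℤ) : Integrable (cotDiff k) :=
  Integrable.of_bound (measurable_cotDiff k).aestronglyMeasurable (2 * |(k : ℝ)|)
    (ae_of_all _ (norm_cotDiff_le k))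

theorem integral_fourier (k : ℤ) :
    ∫ x : Torus, fourier k x = if k = 0 then ((2 * π : ℝ) : ℂ) else 0 := by
  have h := congrFun (fourierCoeff_fourier (T := 2 * π) k) 0
  have hp : ((2 * π : ℝ) : ℂ) ≠ 0 := by exact_mod_cast Real.two_pi_pos.ne'
  rw [fourierCoeff_eq_integral_volume, inv_mul_eq_iff_eq_mul₀ hp] at h
  simp only [neg_zero, fourier_zero, one_mul] at h
  rw [h]
  by_cases hk : k = 0
  · subst hk; simp
  · rw [Pi.single_eq_of_ne (Ne.symm hk), mul_zero, if_neg hk]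

theorem ae_ne (a : Torus) : ∀ᵐ x : Torus, x ≠ a := by
  rw [ae_iff]
  have h := AddCircle.volume_closedBall (2 * π) (x := a) 0
  rw [Metric.closedBall_zero, mul_zero, min_eq_right Real.two_pi_pos.le, ENNReal.ofReal_zero] at h
  simpa using h

theorem ae_ne_zero : ∀ᵐ x : Torus, x ≠ 0 := ae_ne 0

/-- Because `(e^{is} - 1) cot(s/2) = i (e^{is} + 1)`, consecutive integrands differ by a
trigonometric polynomial. This gives a recursion in `k` that evaluates all the integrals. -/
theorem integral_cotDiff_succ (k : ℤ) : ∫ x, cotDiff (k + 1) x =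
    ∫ x, cotDiff k x - Complex.I * (fourier (-k) x + fourier (-(k + 1)) x) := by
  apply integral_congr_ae
  filter_upwards [ae_ne_zero] with x hx
  have h := fourier_one_sub_one_mul_invTanHalf hx
  have e : fourier (-k) x = fourier (-(k + 1)) x * fourier 1 x := by
    rw [← fourier_add]; congr 2; ring
  simp only [cotDiff]
  rw [e]
  linear_combination (-fourier (-(k + 1)) x) * h

theorem integral_cotDiff (k : ℤ) :
    ∫ x, cotDiff k x = -(((2 * π : ℝ) : ℂ) * (Complex.I * (k.sign : ℂ))) := by
  have step : ∀ k : ℤ, ∫ x, cotDiff (k + 1) x = (∫ x, cotDiff k x) - Complex.I *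
      ((if k = 0 then ((2 * π : ℝ) : ℂ) else 0) + if k = -1 then ((2 * π : ℝ) : ℂ) else 0) := by
    intro k
    have h1 := integrable_of_continuous (fourier (T := 2 * π) (-k)).continuous
    have h2 := integrable_of_continuous (fourier (T := 2 * π) (-(k + 1))).continuous
    have h12 : Integrable fun x : Torus => fourier (-k) x + fourier (-(k + 1)) x := h1.add h2
    rw [integral_cotDiff_succ, integral_sub (integrable_cotDiff k) (h12.const_mul _),
      integral_const_mul, integral_add h1 h2, integral_fourier, integral_fourier]
    have e1 : -k = 0 ↔ k = 0 := by omega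
    have e2 : -(k + 1) = 0 ↔ k = -1 := by omega
    simp only [e1, e2]
  have h0 : ∫ x, cotDiff 0 x = 0 := by simp [cotDiff]
  induction k using Int.induction_on with
  | zero => simp [h0]
  | succ n ih =>
    rw [step, ih]
    have e2 : ¬ ((n : ℤ) = -1) := by omega
    have e3 : ((n : ℤ) + 1).sign = 1 := Int.sign_eq_one_of_pos (by omega)
    rw [if_neg e2, e3]
    by_cases hn : (n : ℤ) = 0
    · rw [if_pos hn, hn]; simp; ring
    · have e4 : (n : ℤ).sign = 1 := Int.sign_eq_one_of_pos (by omega)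
      rw [if_neg hn, e4]; simp
  | pred n ih =>
    have hs := step (-(n : ℤ) - 1)
    rw [sub_add_cancel, ih] at hs
    have e1 : ¬ (-(n : ℤ) - 1 = 0) := by omega
    have e3 : (-(n : ℤ) - 1).sign = -1 := Int.sign_eq_neg_one_of_neg (by omega)
    rw [if_neg e1] at hs
    rw [e3]
    by_cases hn : n = 0
    · subst hn
      simp at hs ⊢
      linear_combination -hs
    · have e4 : (-(n : ℤ)).sign = -1 := Int.sign_eq_neg_one_of_neg (by omega)
      rw [if_neg (by omega), e4] at hs
      simp at hs ⊢
      linear_combination -hs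

/-! ### The Hilbert transform of `H¹` functions -/

/-- The set `|e^{is} - 1| > ε`. -/
def farSet (ε : ℝ) : Set Torus := {s | ε < 2 * absSinHalf s}

theorem measurableSet_farSet (ε : ℝ) : MeasurableSet (farSet ε) :=
  (isOpen_lt continuous_const (continuous_const.mul continuous_absSinHalf)).measurableSet

theorem integrableOn_invTanHalf {ε : ℝ} (hε : 0 < ε) :
    IntegrableOn (fun s => (invTanHalf s : ℂ)) (farSet ε) := by
  refine Integrable.of_bound
    (Complex.measurable_ofReal.comp measurable_invTanHalf).aestronglyMeasurable (2 / ε) ?_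
  filter_upwards [ae_restrict_mem (measurableSet_farSet ε)] with s hs
  have hs' : ε < 2 * absSinHalf s := hs
  have h := abs_invTanHalf_mul_le s
  rw [Complex.norm_real, Real.norm_eq_abs, le_div_iff₀ hε]
  nlinarith [abs_nonneg (invTanHalf s)]

theorem setIntegral_invTanHalf (ε : ℝ) : ∫ s in farSet ε, (invTanHalf s : ℂ) = 0 := by
  rw [← integral_indicator (measurableSet_farSet ε)]
  have h := integral_neg_eq_self
    ((farSet ε).indicator fun s : Torus => (invTanHalf s : ℂ)) (volume : Measure Torus)
  have e : ∀ x, (farSet ε).indicator (fun s : Torus => (invTanHalf s : ℂ)) (-x)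
      = -(farSet ε).indicator (fun s : Torus => (invTanHalf s : ℂ)) x := by
    intro x
    have hm : -x ∈ farSet ε ↔ x ∈ farSet ε := by
      simp only [farSet, Set.mem_ofPred_eq, absSinHalf_neg]
    by_cases hx : x ∈ farSet ε
    · rw [Set.indicator_of_mem hx, Set.indicator_of_mem (hm.2 hx), invTanHalf_neg,
        Complex.ofReal_neg]
    · rw [Set.indicator_of_notMem hx, Set.indicator_of_notMem (mt hm.1 hx), neg_zero]
  simp only [e, integral_neg] at h
  exact self_eq_neg.1 h.symm

/-- The cotangent is odd and the truncation set symmetric, so subtracting `1` from the exponential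
costs nothing and removes the singularity. -/
theorem setIntegral_fourier_mul_invTanHalf {ε : ℝ} (hε : 0 < ε) (k : ℤ) :
    ∫ s in farSet ε, fourier (-k) s * (invTanHalf s : ℂ) = ∫ s in farSet ε, cotDiff k s := by
  have h : ∀ s, fourier (-k) s * (invTanHalf s : ℂ) = cotDiff k s + (invTanHalf s : ℂ) := by
    intro s; rw [cotDiff]; ring
  simp only [h]
  rw [integral_add (integrable_cotDiff k).integrableOn (integrableOn_invTanHalf hε),
    setIntegral_invTanHalf, add_zero]

theorem norm_setIntegral_cotDiff_le (k : ℤ) (ε : ℝ) : ‖∫ s in farSet ε, cotDiff k s‖ ≤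
    |(k : ℝ)| ^ (1 / 4 : ℝ) * ∫ x : Torus, 4 * (2 * absSinHalf x) ^ (-(3 / 4) : ℝ) := by
  have hi := (integrable_absSinHalf_rpow.const_mul 4).const_mul (|(k : ℝ)| ^ (1 / 4 : ℝ))
  rw [← integral_const_mul]
  refine (norm_integral_le_of_norm_le hi.integrableOn
    (ae_of_all _ fun x => norm_cotDiff_le_rpow k x)).trans ?_
  refine setIntegral_le_integral hi (ae_of_all _ fun x => ?_)
  have := absSinHalf_nonneg x
  simp only [Pi.zero_apply]
  positivity

theorem tendsto_setIntegral_cotDiff (k : ℤ) :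
    Tendsto (fun ε => ∫ s in farSet ε, cotDiff k s) (𝓝[>] 0) (𝓝 (∫ s, cotDiff k s)) := by
  simp_rw [← integral_indicator (measurableSet_farSet _)]
  refine tendsto_integral_filter_of_dominated_convergence (fun _ => 2 * |(k : ℝ)|)
    (Eventually.of_forall fun ε => ?_) (Eventually.of_forall fun ε => ae_of_all _ fun x => ?_)
    (integrable_const _) ?_
  · exact ((measurable_cotDiff k).indicator (measurableSet_farSet ε)).aestronglyMeasurable
  · exact (norm_indicator_le_norm_self _ _).trans (norm_cotDiff_le k x)
  · filter_upwards [ae_ne_zero] with x hx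
    refine tendsto_const_nhds.congr' ?_
    have hp : 0 < 2 * absSinHalf x := mul_pos two_pos (absSinHalf_pos hx)
    filter_upwards [nhdsWithin_le_nhds (Iio_mem_nhds hp)] with ε hε
    exact (Set.indicator_of_mem (show x ∈ farSet ε from hε) _).symm

theorem fourier_sub (k : ℤ) (x y : Torus) : fourier k (x - y) = fourier k x * fourier (-k) y := by
  rw [fourier_apply, fourier_apply, fourier_apply, ← Circle.coe_mul, ← AddCircle.toCircle_add]
  congr 2
  rw [zsmul_sub, neg_zsmul, sub_eq_add_neg]

/-- For fixed `ε > 0` the cotangent is integrable on the truncation set, so the absolutely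
convergent Fourier series may be integrated term by term. -/
theorem hasSum_truncatedHilbert {f F : Torus → ℝ} (hf : f =ᵐ[volume] F)
    (hs : Summable fun k : ℤ => ‖realCoeff f k‖)
    (hF : ∀ x, HasSum (fun k : ℤ => realCoeff f k * fourier k x) (F x : ℂ))
    {ε : ℝ} (hε : 0 < ε) (x : Torus) :
    HasSum (fun k : ℤ => realCoeff f k * fourier k x * ∫ s in farSet ε, cotDiff k s)
      (((2 * π : ℝ) : ℂ) * (truncatedHilbert f x ε : ℂ)) := by
  have h2 : (((2 * π : ℝ) : ℂ) * (truncatedHilbert f x ε : ℂ))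
      = ∫ s in farSet ε, (F (x - s) : ℂ) * (invTanHalf s : ℂ) := by
    have hset : MeasurableSet {t : Torus | ε < 2 * absSinHalf (x - t)} :=
      (measurable_const.sub measurable_id) (measurableSet_farSet ε)
    rw [truncatedHilbert, ← Complex.ofReal_mul, mul_inv_cancel_left₀ Real.two_pi_pos.ne',
      ← integral_complex_ofReal, ← integral_indicator hset,
      ← integral_indicator (measurableSet_farSet ε)]
    rw [← integral_sub_left_eq_self
      ((farSet ε).indicator fun s : Torus => (F (x - s) : ℂ) * (invTanHalf s : ℂ)) volume x]
    apply integral_congr_ae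
    filter_upwards [hf] with t ht
    simp only [Set.indicator_apply, farSet, Set.mem_ofPred_eq, sub_sub_cancel, ht,
      Complex.ofReal_mul]
  rw [h2]
  have h3 : ∀ k : ℤ, realCoeff f k * fourier k x * ∫ s in farSet ε, cotDiff k s =
      ∫ s in farSet ε, realCoeff f k * fourier k (x - s) * (invTanHalf s : ℂ) := by
    intro k
    rw [← setIntegral_fourier_mul_invTanHalf hε, ← integral_const_mul]
    congr 1; funext s
    rw [fourier_sub]; ring
  simp only [h3]
  refine hasSum_integral_of_dominated_convergence
    (fun k s => ‖realCoeff f k‖ * ‖(invTanHalf s : ℂ)‖) (fun k => ?_)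
    (fun k => ae_of_all _ fun s => ?_) (ae_of_all _ fun s => hs.mul_right _) ?_
    (ae_of_all _ fun s => ?_)
  · refine (Measurable.mul ?_ (Complex.measurable_ofReal.comp
      measurable_invTanHalf)).aestronglyMeasurable
    exact (continuous_const.mul ((fourier k).continuous.comp
      (continuous_const.sub continuous_id))).measurable
  · rw [norm_mul, norm_mul, norm_fourier_apply, mul_one]
  · simp_rw [tsum_mul_right]
    exact (integrableOn_invTanHalf hε).norm.const_mul _
  · exact (hF (x - s)).mul_right _

/-- The coefficients `i sgn(k) f̂_k` of the Hilbert transform. -/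
def hilbertCoeff (f : Torus → ℝ) (k : ℤ) : ℂ := Complex.I * (k.sign : ℂ) * realCoeff f k

theorem norm_hilbertCoeff_le (f : Torus → ℝ) (k : ℤ) : ‖hilbertCoeff f k‖ ≤ ‖realCoeff f k‖ := by
  rw [hilbertCoeff, norm_mul, norm_mul, Complex.norm_I, one_mul]
  refine mul_le_of_le_one_left (norm_nonneg _) ?_
  rcases Int.sign_trichotomy k with h | h | h <;> rw [h] <;> simp

/-- The limit `ε → 0` passes under the sum over `k`: the truncated integrals are `O(|k|^{1/4})`
uniformly in `ε`, and `|k|^{1/4} |f̂_k|` is summable. The principal value therefore exists at every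
point, not merely almost everywhere. -/
theorem HasL2Deriv.hasSum_hilbert {f g : Torus → ℝ} (h : HasL2Deriv f g) (x : Torus) :
    HasSum (fun k : ℤ => hilbertCoeff f k * fourier k x) (hilbert f x : ℂ) := by
  obtain ⟨F, -, hfF, hF⟩ := h.exists_continuous
  have hs := h.summable_norm
  have hp : ((2 * π : ℝ) : ℂ) ≠ 0 := by exact_mod_cast Real.two_pi_pos.ne'
  have hlim : Tendsto
      (fun ε => ∑' k : ℤ, realCoeff f k * fourier k x * ∫ s in farSet ε, cotDiff k s)
      (𝓝[>] 0) (𝓝 (∑' k : ℤ, realCoeff f k * fourier k x * ∫ s, cotDiff k s)) := by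
    refine tendsto_tsum_of_dominated_convergence (h.summable_rpow_mul_norm.mul_right
      (∫ x : Torus, 4 * (2 * absSinHalf x) ^ (-(3 / 4) : ℝ)))
      (fun k => (tendsto_setIntegral_cotDiff k).const_mul _)
      (Eventually.of_forall fun ε k => ?_)
    rw [norm_mul, norm_mul, norm_fourier_apply, mul_one]
    refine (mul_le_mul_of_nonneg_left (norm_setIntegral_cotDiff_le k ε) (norm_nonneg _)).trans_eq ?_
    ring
  have hsum : Summable fun k : ℤ => hilbertCoeff f k * fourier k x := by
    refine Summable.of_norm_bounded hs fun k => ?_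
    rw [norm_mul, norm_fourier_apply, mul_one]
    exact norm_hilbertCoeff_le f k
  have hval : ∑' k : ℤ, realCoeff f k * fourier k x * ∫ s, cotDiff k s
      = ((2 * π : ℝ) : ℂ) * -∑' k : ℤ, hilbertCoeff f k * fourier k x := by
    rw [← tsum_neg, ← tsum_mul_left]
    congr 1; funext k
    rw [integral_cotDiff, hilbertCoeff]; ring
  rw [hval] at hlim
  have hlim2 : Tendsto (fun ε => (truncatedHilbert f x ε : ℂ)) (𝓝[>] 0)
      (𝓝 (-∑' k : ℤ, hilbertCoeff f k * fourier k x)) := by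
    have h1 := hlim.const_mul (((2 * π : ℝ) : ℂ)⁻¹)
    rw [inv_mul_cancel_left₀ hp] at h1
    refine h1.congr' ?_
    filter_upwards [self_mem_nhdsWithin] with ε hε
    rw [(hasSum_truncatedHilbert hfF hs hF hε x).tsum_eq, inv_mul_cancel_left₀ hp]
  have hre := (Complex.continuous_re.tendsto _).comp hlim2
  have him := (Complex.continuous_im.tendsto _).comp hlim2
  -- The truncated transforms are real, hence so is their limit; only then does the real `limUnder`
  -- determine the complex sum.
  have him0 : (-∑' k : ℤ, hilbertCoeff f k * fourier k x).im = 0 := by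
    refine tendsto_nhds_unique him ?_
    simp only [Function.comp_def, Complex.ofReal_im]
    exact tendsto_const_nhds
  have e : (hilbert f x : ℂ) = ∑' k : ℤ, hilbertCoeff f k * fourier k x := by
    have : truncatedHilbert f x = Complex.re ∘ fun ε => (truncatedHilbert f x ε : ℂ) := by
      funext ε; simp
    rw [hilbert, this, hre.limUnder_eq]
    apply Complex.ext
    · simp
    · rw [Complex.neg_im, neg_eq_zero] at him0
      rw [Complex.ofReal_im, him0]
  rw [e]
  exact hsum.hasSum

theorem exists_hilbertCoeff {f : Torus → ℝ} (hf : MemLp f 2 volume) :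
    ∃ u : Torus → ℝ, MemLp u 2 volume ∧ ∀ k, realCoeff u k = hilbertCoeff f k :=
  exists_memLp_realCoeff
    ((hasSum_norm_sq_realCoeff hf).summable.of_nonneg_of_le (fun k => by positivity)
      fun k => by gcongr; exact norm_hilbertCoeff_le f k)
    (fun k => by simp [hilbertCoeff, realCoeff_neg])

theorem HasL2Deriv.memLp_hilbert_and_realCoeff {f g : Torus → ℝ} (h : HasL2Deriv f g) :
    MemLp (hilbert f) 2 volume ∧ ∀ k, realCoeff (hilbert f) k = hilbertCoeff f k := by
  obtain ⟨u, hu, huc⟩ := exists_hilbertCoeff h.memLp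
  obtain ⟨U, -, hU, hsum⟩ := exists_continuous_hasSum hu
    (h.summable_norm.of_nonneg_of_le (fun k => norm_nonneg _) fun k => by
      rw [huc]; exact norm_hilbertCoeff_le f k)
  have e : hilbert f = U := by
    funext x
    have h1 := hsum x
    simp only [huc] at h1
    exact_mod_cast (h.hasSum_hilbert x).unique h1
  rw [e]
  exact ⟨hu.ae_eq hU, fun k => by rw [← realCoeff_congr hU, huc]⟩

/-! ### The logarithmic kernel -/

/-- The finite values `-log |sin (x / 2)|` of the logarithmic kernel. -/
def logKer (x : Torus) : ℝ := -Real.log (absSinHalf x)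

theorem logKer_nonneg (x : Torus) : 0 ≤ logKer x :=
  neg_nonneg.2 (Real.log_nonpos (absSinHalf_nonneg x) (absSinHalf_le_one x))

theorem measurable_logKer : Measurable logKer :=
  (Real.measurable_log.comp continuous_absSinHalf.measurable).neg

theorem logKernel_eq {x : Torus} (hx : x ≠ 0) : logKernel x = ENNReal.ofReal (logKer x) := by
  rw [logKernel, if_neg hx]; rfl

theorem logKer_neg (x : Torus) : logKer (-x) = logKer x := by
  rw [logKer, logKer, absSinHalf_neg]

theorem integrable_logKer : Integrable logKer := by
  refine ((integrable_const (1 : ℝ)).add (integrable_absSinHalf_rpow.const_mul (4 / 3))).mono'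
    measurable_logKer.aestronglyMeasurable ?_
  filter_upwards [ae_ne_zero] with x hx
  have hp := absSinHalf_pos hx
  have hq : 0 < 2 * absSinHalf x := by linarith
  rw [Real.norm_of_nonneg (logKer_nonneg x), logKer]
  -- The exponent `3/4` reuses the integrable power above; the `log 2` from the factor in `2 |sin|`
  -- is absorbed by the constant `1`.
  have h1 := Real.log_le_rpow_div (inv_nonneg.2 hq.le) (by norm_num : (0 : ℝ) < 3 / 4)
  rw [Real.inv_rpow hq.le, ← Real.rpow_neg hq.le, Real.log_inv,
    Real.log_mul two_ne_zero hp.ne'] at h1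
  have h2 := Real.log_two_lt_d9
  simp only [Pi.add_apply]
  linarith

/-- The first-order zero of `e^{-ikx} - 1` beats the logarithm. Continuity up to the singular point
allows the fundamental theorem of calculus over a full period. -/
theorem continuous_fourier_sub_one_mul_logKer (k : ℤ) :
    Continuous fun x : Torus => (fourier (-k) x - 1) * (logKer x : ℂ) := by
  rw [continuous_iff_continuousAt]
  intro x
  by_cases hx : x = 0
  · subst hx
    have h0 : (fourier (-k) (0 : Torus) - 1) * (logKer 0 : ℂ) = 0 := by
      rw [fourier_eval_zero, sub_self, zero_mul]
    rw [ContinuousAt, h0]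
    have hc : Continuous fun x : Torus =>
        |(k : ℝ)| * (2 * |absSinHalf x * Real.log (absSinHalf x)|) :=
      continuous_const.mul (continuous_const.mul
        (Real.continuous_mul_log.comp continuous_absSinHalf).abs)
    have hz : absSinHalf 0 = 0 := by simpa using absSinHalf_coe 0
    have ht := hc.tendsto 0
    simp only [hz, zero_mul, abs_zero, mul_zero] at ht
    refine squeeze_zero_norm (fun y => ?_) ht
    have h1 := norm_fourier_sub_one_le (-k) y
    push_cast at h1
    rw [abs_neg] at h1
    rw [norm_mul, Complex.norm_real, logKer, norm_neg, Real.norm_eq_abs, abs_mul,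
      abs_of_nonneg (absSinHalf_nonneg y)]
    calc _ ≤ |(k : ℝ)| * (2 * absSinHalf y) * |Real.log (absSinHalf y)| := by gcongr
      _ = _ := by ring
  · have h1 : ContinuousAt logKer x :=
      (continuous_absSinHalf.continuousAt.log (absSinHalf_pos hx).ne').neg
    exact ((fourier (-k)).continuous.sub continuous_const).continuousAt.mul
      (Complex.continuous_ofReal.continuousAt.comp h1)

theorem hasDerivAt_logKer {t : ℝ} (ht : Real.sin (t / 2) ≠ 0) :
    HasDerivAt (fun s : ℝ => logKer (s : Torus)) (-(invTanHalf (t : Torus) / 2)) t := by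
  have h1 : HasDerivAt (fun s : ℝ => Real.sin (s / 2)) (Real.cos (t / 2) * (1 / 2)) t :=
    ((hasDerivAt_id t).div_const 2).sin
  have h2 := (h1.log ht).neg
  have e : (fun s : ℝ => logKer (s : Torus)) = fun s => -Real.log (Real.sin (s / 2)) := by
    funext s; rw [logKer, absSinHalf_coe, Real.log_abs]
  rw [e]
  convert! h2 using 1
  rw [invTanHalf_coe, Real.tan_eq_sin_div_cos, inv_div]
  field_simp

/-- The integral of the logarithmic kernel against `e^{-ikx}`. -/
def logKerCoeff (k : ℤ) : ℂ := ∫ x : Torus, fourier (-k) x * (logKer x : ℂ)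

/-- Integrate the derivative of `(e^{-ikx} - 1) · logKer` over a period: the boundary terms cancel,
and since the kernel has derivative `-cot(x/2) / 2`, what remains is the known integral of
`cotDiff`. -/
theorem mul_logKerCoeff (k : ℤ) :
    (k : ℂ) * logKerCoeff k = ((π : ℝ) : ℂ) * (k.sign : ℂ) := by
  have hi1 : Integrable fun x : Torus => fourier (-k) x * (logKer x : ℂ) :=
    integrable_fourier_mul (integrable_ofReal integrable_logKer) (-k)
  have hi2 := integrable_cotDiff k
  have hI : Integrable fun x : Torus => Complex.I * (-k : ℤ) * (fourier (-k) x * (logKer x : ℂ))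
      - cotDiff k x / 2 := (hi1.const_mul _).sub (hi2.div_const 2)
  have hII := (integrable_iff_coe hI.1 0).1 hI
  rw [zero_add] at hII
  have hd : ∀ t ∈ Set.Ioo (0 : ℝ) (2 * π), HasDerivAt
      (fun s : ℝ => (fourier (-k) (s : Torus) - 1) * (logKer (s : Torus) : ℂ))
      ((fun x : Torus => Complex.I * (-k : ℤ) * (fourier (-k) x * (logKer x : ℂ))
        - cotDiff k x / 2) t) t := by
    intro t ht
    have hs : Real.sin (t / 2) ≠ 0 :=
      (Real.sin_pos_of_pos_of_lt_pi (by linarith [ht.1]) (by linarith [ht.2])).ne'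
    have h := ((hasDerivAt_fourier_two_pi (-k) t).sub_const 1).mul
      (hasDerivAt_logKer hs).ofReal_comp
    convert! h using 1
    simp only [cotDiff]
    push_cast
    ring
  have h0 := intervalIntegral.integral_eq_sub_of_hasDerivAt_of_le (a := 0) (b := 2 * π)
    Real.two_pi_pos.le ((continuous_fourier_sub_one_mul_logKer k).comp
      (AddCircle.continuous_mk' _)).continuousOn hd
    ((intervalIntegrable_iff_integrableOn_Ioc_of_le Real.two_pi_pos.le).2 hII)
  have hT := AddCircle.intervalIntegral_preimage (2 * π) 0
    (fun x : Torus => Complex.I * (-k : ℤ) * (fourier (-k) x * (logKer x : ℂ)) - cotDiff k x / 2)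
  rw [zero_add] at hT
  rw [hT] at h0
  simp only [Function.comp_apply, QuotientAddGroup.mk'_apply] at h0
  have hp : ((2 * π : ℝ) : Torus) = ((0 : ℝ) : Torus) := by
    rw [AddCircle.coe_period]; rfl
  rw [hp, sub_self, integral_sub (hi1.const_mul _) (hi2.div_const 2), integral_const_mul,
    integral_div, integral_cotDiff] at h0
  have hI2 := Complex.I_mul_I
  have hI0 := Complex.I_ne_zero
  have h1 : Complex.I * ((k : ℂ) * logKerCoeff k) = Complex.I * (((π : ℝ) : ℂ) * (k.sign : ℂ)) := by
    rw [logKerCoeff]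
    push_cast at h0 ⊢
    linear_combination -h0
  exact mul_left_cancel₀ hI0 h1

/-! ### Measures with a continuous density -/

/-- The measure with density `f`. -/
def densityMeasure (f : Torus → ℝ) : Measure Torus :=
  volume.withDensity fun x => ENNReal.ofReal (f x)

theorem integral_densityMeasure {f : Torus → ℝ} (hf : Continuous f) (h0 : ∀ x, 0 ≤ f x)
    (g : Torus → ℝ) : ∫ x, g x ∂densityMeasure f = ∫ x, f x * g x := by
  rw [densityMeasure, integral_withDensity_eq_integral_toReal_smul (by fun_prop) (by simp)]
  simp [ENNReal.toReal_ofReal, h0]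

theorem integrable_densityMeasure_iff {f : Torus → ℝ} (hf : Continuous f) (h0 : ∀ x, 0 ≤ f x)
    {g : Torus → ℝ} : Integrable g (densityMeasure f) ↔ Integrable fun x => f x * g x := by
  rw [densityMeasure, integrable_withDensity_iff_integrable_smul' (by fun_prop) (by simp)]
  simp [ENNReal.toReal_ofReal, h0]

theorem densityMeasure_univ {f : Torus → ℝ} (hf : Continuous f) (h0 : ∀ x, 0 ≤ f x) :
    densityMeasure f Set.univ = ENNReal.ofReal (∫ x, f x) := by
  rw [densityMeasure, withDensity_apply _ MeasurableSet.univ, setLIntegral_univ,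
    ofReal_integral_eq_lintegral_ofReal (integrable_of_continuous hf) (ae_of_all _ h0)]

theorem isProbabilityMeasure_densityMeasure {f : Torus → ℝ} (hf : Continuous f)
    (h0 : ∀ x, 0 ≤ f x) (h1 : ∫ x, f x = 1) : IsProbabilityMeasure (densityMeasure f) :=
  ⟨by rw [densityMeasure_univ hf h0, h1, ENNReal.ofReal_one]⟩

theorem densityMeasure_absolutelyContinuous (f : Torus → ℝ) : densityMeasure f ≪ volume :=
  withDensity_absolutelyContinuous _ _

/-! ### The logarithmic potential -/

/-- The logarithmic potential of the density `f`. -/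
def logPot (f : Torus → ℝ) (x : Torus) : ℝ := ∫ y, logKer (x - y) * f y

theorem logPot_eq (f : Torus → ℝ) (x : Torus) : logPot f x = ∫ s, logKer s * f (x - s) := by
  rw [logPot, ← integral_sub_left_eq_self (fun s => logKer s * f (x - s)) volume x]
  simp only [sub_sub_cancel]

theorem exists_bound {f : Torus → ℝ} (hf : Continuous f) : ∃ M, 0 ≤ M ∧ ∀ x, |f x| ≤ M := by
  obtain ⟨M, hM⟩ := (isCompact_range hf.norm).bddAbove
  exact ⟨M, (norm_nonneg (f 0)).trans (hM ⟨0, rfl⟩), fun x => hM ⟨x, rfl⟩⟩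

theorem integrable_logKer_mul {f : Torus → ℝ} (hf : Continuous f) (x : Torus) :
    Integrable fun y => logKer (x - y) * f y := by
  obtain ⟨M, -, hM⟩ := exists_bound hf
  exact (integrable_logKer.comp_sub_left x).mul_bdd hf.aestronglyMeasurable (ae_of_all _ hM)

theorem continuous_logPot {f : Torus → ℝ} (hf : Continuous f) : Continuous (logPot f) := by
  obtain ⟨M, -, hM⟩ := exists_bound hf
  have e : logPot f = fun x => ∫ s, logKer s * f (x - s) := funext (logPot_eq f)
  rw [e]
  refine continuous_of_dominated (bound := fun s => logKer s * M) (fun x => ?_)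
    (fun x => ae_of_all _ fun s => ?_) (integrable_logKer.mul_const M) (ae_of_all _ fun s => ?_)
  · exact measurable_logKer.aestronglyMeasurable.mul
      (hf.comp (continuous_const.sub continuous_id)).aestronglyMeasurable
  · rw [norm_mul, Real.norm_of_nonneg (logKer_nonneg s)]
    exact mul_le_mul_of_nonneg_left (hM _) (logKer_nonneg s)
  · fun_prop

theorem logPot_add_smul {f h : Torus → ℝ} (hf : Continuous f) (hh : Continuous h) (t : ℝ)
    (x : Torus) : logPot (fun y => f y + t * h y) x = logPot f x + t * logPot h x := by
  have h1 := integrable_logKer_mul hf x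
  have h2 := (integrable_logKer_mul hh x).const_mul t
  simp only [logPot]
  rw [← integral_const_mul, ← integral_add h1 h2]
  congr 1; funext y; ring

theorem integral_mul_logPot_comm {f h : Torus → ℝ} (hf : Continuous f) (hh : Continuous h) :
    ∫ x, h x * logPot f x = ∫ x, f x * logPot h x := by
  obtain ⟨M, -, hM⟩ := exists_bound hh
  have h1 := Integrable.convolution_integrand (ContinuousLinearMap.mul ℝ ℝ)
    (μ := (volume : Measure Torus)) (ν := (volume : Measure Torus))
    (integrable_of_continuous hf) integrable_logKer
  have h2 : Integrable (fun p : Torus × Torus => h p.1 * (f p.2 * logKer (p.1 - p.2)))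
      (volume.prod volume) :=
    h1.bdd_mul (c := M) (hh.comp continuous_fst).aestronglyMeasurable (ae_of_all _ fun p => hM p.1)
  have e1 : ∀ x, h x * logPot f x = ∫ y, h x * (f y * logKer (x - y)) := fun x => by
    rw [logPot, ← integral_const_mul]
    congr 1; funext y; ring
  have e2 : ∀ y, f y * logPot h y = ∫ x, h x * (f y * logKer (x - y)) := fun y => by
    rw [logPot, ← integral_const_mul]
    congr 1; funext x
    rw [← logKer_neg, neg_sub]; ring
  simp only [e1, e2]
  exact integral_integral_swap h2

theorem logEnergy_densityMeasure {f : Torus → ℝ} (hf : Continuous f) (h0 : ∀ x, 0 ≤ f x) :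
    logEnergy (densityMeasure f) = ENNReal.ofReal (∫ x, f x * logPot f x) := by
  have h1 : ∀ x, ∫⁻ y, logKernel (x - y) ∂densityMeasure f = ENNReal.ofReal (logPot f x) := by
    intro x
    have hne : ∀ᵐ y ∂densityMeasure f, x - y ≠ 0 := by
      refine (densityMeasure_absolutelyContinuous f).ae_le ?_
      filter_upwards [ae_ne x] with y hy
      exact sub_ne_zero.2 hy.symm
    have hi : Integrable (fun y => logKer (x - y)) (densityMeasure f) := by
      rw [integrable_densityMeasure_iff hf h0]
      simpa only [mul_comm] using integrable_logKer_mul hf x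
    have e : logPot f x = ∫ y, logKer (x - y) ∂densityMeasure f := by
      rw [integral_densityMeasure hf h0, logPot]
      simp only [mul_comm]
    rw [e, ofReal_integral_eq_lintegral_ofReal hi (ae_of_all _ fun y => logKer_nonneg _)]
    apply lintegral_congr_ae
    filter_upwards [hne] with y hy
    exact logKernel_eq hy
  have hi : Integrable (logPot f) (densityMeasure f) := by
    rw [integrable_densityMeasure_iff hf h0]
    exact integrable_of_continuous (hf.mul (continuous_logPot hf))
  have hp : ∀ x, 0 ≤ logPot f x := fun x =>
    integral_nonneg fun y => mul_nonneg (logKer_nonneg _) (h0 y)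
  rw [logEnergy]
  simp only [h1]
  rw [← ofReal_integral_eq_lintegral_ofReal hi (ae_of_all _ hp), integral_densityMeasure hf h0]

/-! ### The free energy of a positive continuous density -/

theorem klDiv_densityMeasure {f W : Torus → ℝ} (hf : Continuous f) (h0 : ∀ x, 0 < f x)
    (h1 : ∫ x, f x = 1) (hW : Continuous W) :
    InformationTheory.klDiv (densityMeasure f) (refMeasure W) ≠ ⊤ ∧
    (InformationTheory.klDiv (densityMeasure f) (refMeasure W)).toReal =
      (∫ x, f x * (Real.log (f x) + W x)) + Real.log (∫ x, Real.exp (-W x)) := by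
  have h0' : ∀ x, 0 ≤ f x := fun x => (h0 x).le
  have hP := isProbabilityMeasure_densityMeasure hf h0' h1
  have hac := densityMeasure_absolutelyContinuous f
  have hexp : Integrable fun x => Real.exp (-W x) := integrable_of_continuous (by fun_prop)
  have hlog : Continuous fun x => Real.log (f x) := hf.log fun x => (h0 x).ne'
  have hllr : llr (densityMeasure f) volume =ᵐ[densityMeasure f] fun x => Real.log (f x) := by
    refine hac.ae_le ?_
    filter_upwards [Measure.rnDeriv_withDensity (volume : Measure Torus)
      (f := fun x => ENNReal.ofReal (f x)) (by fun_prop)] with x hx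
    rw [llr, densityMeasure, hx, ENNReal.toReal_ofReal (h0' x)]
  have hcont : ∀ {g : Torus → ℝ}, Continuous g → Integrable g (densityMeasure f) := fun hg =>
    (integrable_densityMeasure_iff hf h0').2 (integrable_of_continuous (hf.mul hg))
  have hi : Integrable (llr (densityMeasure f) volume) (densityMeasure f) :=
    (integrable_congr hllr).2 (hcont hlog)
  have hac2 : densityMeasure f ≪ refMeasure W := hac.trans (absolutelyContinuous_tilted hexp)
  have hi2 : Integrable (llr (densityMeasure f) (refMeasure W)) (densityMeasure f) :=
    integrable_llr_tilted_right hac (hcont hW.neg) hi hexp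
  have : NeZero (volume : Measure Torus) := inferInstance
  have hR : IsProbabilityMeasure (refMeasure W) := isProbabilityMeasure_tilted hexp
  refine ⟨InformationTheory.klDiv_ne_top hac2 hi2, ?_⟩
  rw [InformationTheory.toReal_klDiv_of_measure_eq hac2 (by simp), refMeasure,
    integral_llr_tilted_right (f := fun x => -W x) hac (hcont hW.neg) hexp hi,
    integral_congr_ae hllr,
    integral_densityMeasure hf h0', integral_densityMeasure hf h0',
    ← integral_sub (integrable_of_continuous (by fun_prop))
      (integrable_of_continuous (by fun_prop))]
  congr 2; funext x; ring

/-- The free energy of a density, up to a constant. -/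
def densityEnergy (β : ℝ) (W f : Torus → ℝ) : ℝ :=
  β * (∫ x, f x * logPot f x) + ∫ x, f x * (Real.log (f x) + W x)

theorem freeEnergy_densityMeasure {β : ℝ} (hβ : 0 ≤ β) {f W : Torus → ℝ} (hf : Continuous f)
    (h0 : ∀ x, 0 < f x) (h1 : ∫ x, f x = 1) (hW : Continuous W) {μ : ProbabilityMeasure Torus}
    (hμ : (μ : Measure Torus) = densityMeasure f) :
    freeEnergy β W μ ≠ ⊤ ∧ (freeEnergy β W μ).toReal =
      densityEnergy β W f + Real.log (∫ x, Real.exp (-W x)) := by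
  have h0' : ∀ x, 0 ≤ f x := fun x => (h0 x).le
  obtain ⟨hk, hk'⟩ := klDiv_densityMeasure hf h0 h1 hW
  have hE := logEnergy_densityMeasure hf h0'
  have hE0 : 0 ≤ ∫ x, f x * logPot f x := integral_nonneg fun x => mul_nonneg (h0' x)
    (integral_nonneg fun y => mul_nonneg (logKer_nonneg _) (h0' y))
  rw [freeEnergy, hμ, hE]
  have hfin : ENNReal.ofReal β * ENNReal.ofReal (∫ x, f x * logPot f x) ≠ ⊤ :=
    ENNReal.mul_ne_top ENNReal.ofReal_ne_top ENNReal.ofReal_ne_top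
  refine ⟨ENNReal.add_ne_top.2 ⟨hfin, hk⟩, ?_⟩
  rw [ENNReal.toReal_add hfin hk, hk', ENNReal.toReal_mul, ENNReal.toReal_ofReal hβ,
    ENNReal.toReal_ofReal hE0, densityEnergy]
  ring

/-! ### The Euler–Lagrange equation -/

/-- Apply `log y ≤ y - 1` to `y = (f + t h) / f`. A one-sided bound with quadratic remainder
suffices for the first variation and avoids differentiating under the integral. -/
theorem entropy_perturbation_le {f W h : Torus → ℝ} (hf : Continuous f) (h0 : ∀ x, 0 < f x)
    (hW : Continuous W) (hh : Continuous h) (hint : ∫ x, h x = 0) {t : ℝ}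
    (ht : ∀ x, 0 < f x + t * h x) :
    ∫ x, (f x + t * h x) * (Real.log (f x + t * h x) + W x) ≤
      (∫ x, f x * (Real.log (f x) + W x)) + t * (∫ x, h x * (Real.log (f x) + W x))
        + t ^ 2 * ∫ x, h x ^ 2 / f x := by
  have hlog : Continuous fun x => Real.log (f x) := hf.log fun x => (h0 x).ne'
  have hlog2 : Continuous fun x => Real.log (f x + t * h x) :=
    (by fun_prop : Continuous fun x => f x + t * h x).log fun x => (ht x).ne'
  have hdiv : Continuous fun x => h x ^ 2 / f x := (hh.pow 2).div hf fun x => (h0 x).ne'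
  have i1 : Integrable fun x => f x * (Real.log (f x) + W x) :=
    integrable_of_continuous (by fun_prop)
  have i2 : Integrable fun x => t * (h x * (Real.log (f x) + W x)) :=
    integrable_of_continuous (by fun_prop)
  have i3 : Integrable fun x => t ^ 2 * (h x ^ 2 / f x) := integrable_of_continuous (by fun_prop)
  have i4 : Integrable fun x => t * h x := integrable_of_continuous (by fun_prop)
  have hz : ∫ x, t * h x = 0 := by rw [integral_const_mul, hint, mul_zero]
  rw [← integral_const_mul, ← integral_const_mul]
  have i5 : Integrable fun x => f x * (Real.log (f x) + W x)
      + t * (h x * (Real.log (f x) + W x)) := i1.add i2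
  have i6 : Integrable fun x => f x * (Real.log (f x) + W x)
      + t * (h x * (Real.log (f x) + W x)) + t ^ 2 * (h x ^ 2 / f x) := i5.add i3
  calc _ ≤ ∫ x, (f x * (Real.log (f x) + W x) + t * (h x * (Real.log (f x) + W x))
        + t ^ 2 * (h x ^ 2 / f x)) + t * h x := by
        refine integral_mono (integrable_of_continuous (by fun_prop)) (i6.add i4) fun x => ?_
        have h1 := Real.log_le_sub_one_of_pos (div_pos (ht x) (h0 x))
        rw [Real.log_div (ht x).ne' (h0 x).ne'] at h1
        have h2 : (f x + t * h x) * (Real.log (f x + t * h x)) ≤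
            (f x + t * h x) * (Real.log (f x) + ((f x + t * h x) / f x - 1)) :=
          mul_le_mul_of_nonneg_left (by linarith) (ht x).le
        have h3 : (f x + t * h x) * ((f x + t * h x) / f x - 1)
            = t * h x + t ^ 2 * (h x ^ 2 / f x) := by
          have := (h0 x).ne'
          field_simp; ring
        simp only
        nlinarith
    _ = _ := by
        rw [integral_add i6 i4, hz, add_zero, integral_add i5 i3, integral_add i1 i2]

theorem energy_perturbation {f h : Torus → ℝ} (hf : Continuous f) (hh : Continuous h) (t : ℝ) :
    ∫ x, (f x + t * h x) * logPot (fun y => f y + t * h y) x =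
      (∫ x, f x * logPot f x) + t * (2 * ∫ x, f x * logPot h x)
        + t ^ 2 * ∫ x, h x * logPot h x := by
  have c1 := continuous_logPot hf
  have c2 := continuous_logPot hh
  have i1 : Integrable fun x => f x * logPot f x := integrable_of_continuous (by fun_prop)
  have i2 : Integrable fun x => t * (h x * logPot f x) := integrable_of_continuous (by fun_prop)
  have i3 : Integrable fun x => t * (f x * logPot h x) := integrable_of_continuous (by fun_prop)
  have i4 : Integrable fun x => t ^ 2 * (h x * logPot h x) :=
    integrable_of_continuous (by fun_prop)
  have e : ∀ x, (f x + t * h x) * logPot (fun y => f y + t * h y) x =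
      ((f x * logPot f x + t * (h x * logPot f x)) + t * (f x * logPot h x))
        + t ^ 2 * (h x * logPot h x) := fun x => by
    rw [logPot_add_smul hf hh]; ring
  simp only [e]
  have i5 : Integrable fun x => f x * logPot f x + t * (h x * logPot f x) := i1.add i2
  have i6 : Integrable fun x => f x * logPot f x + t * (h x * logPot f x)
      + t * (f x * logPot h x) := i5.add i3
  rw [integral_add i6 i4, integral_add i5 i3, integral_add i1 i2, integral_const_mul,
    integral_const_mul, integral_const_mul, integral_mul_logPot_comm hf hh]
  ring

theorem eq_zero_of_forall_small {A B r : ℝ} (hr : 0 < r)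
    (h : ∀ t : ℝ, |t| ≤ r → 0 ≤ t * B + t ^ 2 * A) : B = 0 := by
  have key : ∀ c : ℝ, (∀ t : ℝ, 0 < t → t ≤ r → 0 ≤ c + t * A) → 0 ≤ c := by
    intro c hc
    have ht : Tendsto (fun t : ℝ => c + t * A) (𝓝[>] 0) (𝓝 (c + 0 * A)) :=
      ((continuous_const.add (continuous_id.mul continuous_const)).tendsto 0).mono_left
        nhdsWithin_le_nhds
    rw [zero_mul, add_zero] at ht
    refine ge_of_tendsto ht ?_
    filter_upwards [self_mem_nhdsWithin, nhdsWithin_le_nhds (Iio_mem_nhds hr)] with t h1 h2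
    exact hc t h1 (le_of_lt h2)
  have h1 : 0 ≤ B := key B fun t ht htr => by
    have := h t (by rwa [abs_of_pos ht])
    have e : t * (B + t * A) = t * B + t ^ 2 * A := by ring
    exact nonneg_of_mul_nonneg_right (this.trans_eq e.symm) ht
  have h2 : 0 ≤ -B := key (-B) fun t ht htr => by
    have := h (-t) (by rwa [abs_neg, abs_of_pos ht])
    have e : t * (-B + t * A) = -t * B + (-t) ^ 2 * A := by ring
    exact nonneg_of_mul_nonneg_right (this.trans_eq e.symm) ht
  linarith

theorem euler_lagrange {β : ℝ} (hβ : 0 ≤ β) {f W : Torus → ℝ} (hf : Continuous f)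
    (h0 : ∀ x, 0 < f x) (h1 : ∫ x, f x = 1) (hW : Continuous W) {μ : ProbabilityMeasure Torus}
    (hμ : (μ : Measure Torus) = densityMeasure f)
    (hmin : ∀ ν, freeEnergy β W μ ≤ freeEnergy β W ν) {h : Torus → ℝ} (hh : Continuous h)
    (hint : ∫ x, h x = 0) :
    2 * β * (∫ x, f x * logPot h x) + ∫ x, h x * (Real.log (f x) + W x) = 0 := by
  obtain ⟨x₀, -, hx₀⟩ := isCompact_univ.exists_isMinOn Set.univ_nonempty hf.continuousOn
  have hmin₀ : ∀ x, f x₀ ≤ f x := fun x => hx₀ (Set.mem_univ x)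
  obtain ⟨M, hM0, hM⟩ := exists_bound hh
  -- For `|t|` up to this radius the perturbed density stays positive; `M + 1` guards against `M =
  -- 0` and makes the inequality strict.
  have hr : 0 < f x₀ / (M + 1) := div_pos (h0 x₀) (by linarith)
  refine eq_zero_of_forall_small hr (A := β * (∫ x, h x * logPot h x) + ∫ x, h x ^ 2 / f x)
    fun t ht => ?_
  have hpos : ∀ x, 0 < f x + t * h x := fun x => by
    have h2 : |t * h x| < f x := by
      rw [abs_mul]
      calc |t| * |h x| ≤ f x₀ / (M + 1) * M := by gcongr; exact hM x
        _ < f x₀ / (M + 1) * (M + 1) := by gcongr; linarith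
        _ = f x₀ := div_mul_cancel₀ _ (by linarith)
        _ ≤ f x := hmin₀ x
    linarith [neg_abs_le (t * h x)]
  have hft : Continuous fun x => f x + t * h x := by fun_prop
  have h1t : ∫ x, f x + t * h x = 1 := by
    rw [integral_add (integrable_of_continuous hf) ((integrable_of_continuous hh).const_mul t),
      integral_const_mul, hint, h1, mul_zero, add_zero]
  have hPt := isProbabilityMeasure_densityMeasure hft (fun x => (hpos x).le) h1t
  obtain ⟨hf1, hf2⟩ := freeEnergy_densityMeasure hβ hf h0 h1 hW hμ
  obtain ⟨hg1, hg2⟩ := freeEnergy_densityMeasure hβ hft hpos h1t hW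
    (μ := ⟨densityMeasure fun x => f x + t * h x, hPt⟩) rfl
  have hle := ENNReal.toReal_mono hg1 (hmin ⟨densityMeasure fun x => f x + t * h x, hPt⟩)
  rw [hf2, hg2, densityEnergy, densityEnergy, energy_perturbation hf hh] at hle
  have hent := entropy_perturbation_le hf h0 hW hh hint hpos
  linarith

/-! ### Regularity of the equilibrium density -/

theorem logKerCoeff_neg_eq {k : ℤ} (hk : k ≠ 0) :
    logKerCoeff (-k) = ((π * k.sign / k : ℝ) : ℂ) := by
  have hk' : (k : ℂ) ≠ 0 := by exact_mod_cast hk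
  have h := mul_logKerCoeff (-k)
  push_cast at h ⊢
  rw [eq_div_iff hk']
  rw [Int.sign_neg] at h
  push_cast at h
  linear_combination -h

/-- Exponentials diagonalise convolution with the logarithmic kernel, with eigenvalue `π / |k|`,
written here as `π sgn k / k`. -/
theorem logPot_re_fourier {k : ℤ} (hk : k ≠ 0) (c : ℂ) (x : Torus) :
    logPot (fun y => (c * fourier (-k) y).re) x =
      (π * k.sign / k) * (c * fourier (-k) x).re := by
  have hi : Integrable fun s : Torus => c * fourier (-k) x * (fourier (- -k) s * (logKer s : ℂ)) :=
    (integrable_fourier_mul (integrable_ofReal integrable_logKer) _).const_mul _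
  have e : ∀ s, logKer s * (c * fourier (-k) (x - s)).re =
      (c * fourier (-k) x * (fourier (- -k) s * (logKer s : ℂ))).re := fun s => by
    rw [fourier_sub, ← Complex.re_ofReal_mul]
    congr 1; ring
  rw [logPot_eq]
  simp only [e]
  have h2 := integral_re hi
  simp only [RCLike.re_to_complex] at h2
  rw [h2, integral_const_mul]
  have h3 : ∫ s : Torus, fourier (- -k) s * (logKer s : ℂ) = logKerCoeff (-k) := rfl
  rw [h3, logKerCoeff_neg_eq hk, mul_comm, Complex.re_ofReal_mul]

theorem integral_re_fourier_mul {Φ : Torus → ℝ} (hΦ : Integrable Φ) (k : ℤ) (c : ℂ) :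
    ∫ x, (c * fourier (-k) x).re * Φ x = (c * ∫ x, fourier (-k) x * (Φ x : ℂ)).re := by
  have hi : Integrable fun x : Torus => c * (fourier (-k) x * (Φ x : ℂ)) :=
    (integrable_fourier_mul (integrable_ofReal hΦ) _).const_mul c
  have h2 := integral_re hi
  simp only [RCLike.re_to_complex] at h2
  rw [← integral_const_mul, ← h2]
  congr 1; funext x
  rw [← mul_assoc, Complex.re_mul_ofReal]

theorem realCoeff_log_of_minimizer {β : ℝ} (hβ : 0 ≤ β) {f W : Torus → ℝ} (hf : Continuous f)
    (h0 : ∀ x, 0 < f x) (h1 : ∫ x, f x = 1) (hW : Continuous W) {μ : ProbabilityMeasure Torus}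
    (hμ : (μ : Measure Torus) = densityMeasure f)
    (hmin : ∀ ν, freeEnergy β W μ ≤ freeEnergy β W ν) {k : ℤ} (hk : k ≠ 0) :
    realCoeff (fun x => Real.log (f x)) k =
      -(((2 * β * (π * k.sign / k) : ℝ) : ℂ) * realCoeff f k + realCoeff W k) := by
  have hlog : Continuous fun x => Real.log (f x) := hf.log fun x => (h0 x).ne'
  set c₀ : ℝ := 2 * β * (π * k.sign / k) with hc₀
  have iΦ : Integrable fun x => c₀ * f x + (Real.log (f x) + W x) :=
    integrable_of_continuous (by fun_prop)
  have key : ∀ c : ℂ,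
      (c * ∫ x, fourier (-k) x * ((c₀ * f x + (Real.log (f x) + W x) : ℝ) : ℂ)).re = 0 := by
    intro c
    have hh : Continuous fun x : Torus => (c * fourier (-k) x).re := by fun_prop
    have hint : ∫ x : Torus, (c * fourier (-k) x).re = 0 := by
      have h := integral_re_fourier_mul (integrable_const (1 : ℝ)) k c
      simp only [mul_one, Complex.ofReal_one] at h
      rw [h, integral_fourier, if_neg (neg_ne_zero.2 hk)]
      simp
    have hEL := euler_lagrange hβ hf h0 h1 hW hμ hmin hh hint
    simp only [logPot_re_fourier hk] at hEL
    rw [← integral_re_fourier_mul iΦ, ← hEL, ← integral_const_mul, ← integral_add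
      (integrable_of_continuous (by fun_prop)) (integrable_of_continuous (by fun_prop))]
    congr 1; funext x
    rw [hc₀]; ring
  have hz : realCoeff (fun x => c₀ * f x + (Real.log (f x) + W x)) k = 0 := by
    rw [realCoeff_eq_integral]
    set J := ∫ x, fourier (-k) x * ((c₀ * f x + (Real.log (f x) + W x) : ℝ) : ℂ)
    -- The freedom in `c` is used once: `c = conj J` turns the vanishing real part into `|J|² = 0`.
    have h := key (conj J)
    rw [← Complex.normSq_eq_conj_mul_self, Complex.ofReal_re, Complex.normSq_eq_zero] at h
    rw [h, mul_zero]
  rw [realCoeff_add (f := fun x => c₀ * f x) (g := fun x => Real.log (f x) + W x)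
    (integrable_of_continuous (by fun_prop)) (integrable_of_continuous (by fun_prop)),
    realCoeff_add (integrable_of_continuous hlog) (integrable_of_continuous hW),
    realCoeff_const_mul] at hz
  linear_combination hz

/-- The Euler–Lagrange equation says that `log f` is, up to a constant, `-2β` times the logarithmic
potential of `f` minus `W`. Its derivative is `-2πβ Hf - W'`, which is in `L²` because `H` is
bounded there. -/
theorem exists_hasL2Deriv_log_of_minimizer {β : ℝ} (hβ : 0 ≤ β) {f W W' : Torus → ℝ}
    (hf : Continuous f) (h0 : ∀ x, 0 < f x) (h1 : ∫ x, f x = 1) (hW : Continuous W)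
    (hW' : HasL2Deriv W W') {μ : ProbabilityMeasure Torus}
    (hμ : (μ : Measure Torus) = densityMeasure f)
    (hmin : ∀ ν, freeEnergy β W μ ≤ freeEnergy β W ν) :
    ∃ l', HasL2Deriv (fun x => Real.log (f x)) l' := by
  have hlog : Continuous fun x => Real.log (f x) := hf.log fun x => (h0 x).ne'
  obtain ⟨u, hu, huc⟩ := exists_hilbertCoeff (memLp_of_continuous hf 2)
  refine ⟨fun x => (-(2 * β * π)) * u x + (-1) * W' x, memLp_of_continuous hlog 2,
    (hu.const_mul _).add (hW'.memLp_deriv.const_mul _), fun k => ?_⟩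
  rw [realCoeff_add ((integrable_of_memLp_two hu).const_mul _)
    ((integrable_of_memLp_two hW'.memLp_deriv).const_mul _), realCoeff_const_mul,
    realCoeff_const_mul, huc, hW'.coeff, hilbertCoeff]
  by_cases hk : k = 0
  · subst hk; simp
  · have hk' : (k : ℂ) ≠ 0 := by exact_mod_cast hk
    rw [realCoeff_log_of_minimizer hβ hf h0 h1 hW hμ hmin hk]
    push_cast
    field_simp
    ring

theorem exists_minimizer_of_eqMeasure_ne_zero (β : ℝ) (W : Torus → ℝ) (h : eqMeasure β W ≠ 0) :
    ∃ μ : ProbabilityMeasure Torus, (μ : Measure Torus) = eqMeasure β W ∧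
      ∀ ν, freeEnergy β W μ ≤ freeEnergy β W ν := by
  by_cases hex : ∃ μ : ProbabilityMeasure Torus, ∀ ν, freeEnergy β W μ ≤ freeEnergy β W ν
  · exact ⟨hex.choose, by rw [eqMeasure, dif_pos hex], hex.choose_spec⟩
  · exact absurd (by rw [eqMeasure, dif_neg hex]) h

/-- What a positive lower bound of the equilibrium density entails. -/
structure IsRegular (β : ℝ) (W : Torus → ℝ) : Prop where
  iInf_pos : 0 < ⨅ x, eqDensity β W x
  continuous : Continuous (eqDensity β W)
  iInf_le : ∀ x, ⨅ x, eqDensity β W x ≤ eqDensity β W x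
  measure_eq : eqMeasure β W = densityMeasure (eqDensity β W)
  integral_eq_one : ∫ x, eqDensity β W x = 1
  exists_deriv_log : ∃ l', HasL2Deriv (fun x => Real.log (eqDensity β W x)) l'

/-- Positivity of the infimum rules out both default values: the default density `0` has infimum
`0`, and the default measure `0` cannot have a density bounded below by a positive constant. So a
genuine minimizer with a positive continuous density is present. -/
theorem isRegular_of_iInf_pos {β : ℝ} (hβ : 0 ≤ β) {W W' : Torus → ℝ} (hW : Continuous W)
    (hW' : HasL2Deriv W W') (h : 0 < ⨅ x, eqDensity β W x) : IsRegular β W := by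
  have hspec : Continuous (eqDensity β W) ∧ (∀ x, 0 ≤ eqDensity β W x) ∧
      eqMeasure β W = densityMeasure (eqDensity β W) := by
    by_cases hex : ∃ m : Torus → ℝ, Continuous m ∧ (∀ x, 0 ≤ m x) ∧
      eqMeasure β W = volume.withDensity fun x => ENNReal.ofReal (m x)
    · rw [eqDensity, dif_pos hex]
      exact hex.choose_spec
    · rw [eqDensity, dif_neg hex] at h
      simp at h
  obtain ⟨hc, hnn, hμ⟩ := hspec
  have hle : ∀ x, ⨅ x, eqDensity β W x ≤ eqDensity β W x := fun x =>
    ciInf_le ⟨0, by rintro _ ⟨y, rfl⟩; exact hnn y⟩ x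
  have hpos : ∀ x, 0 < eqDensity β W x := fun x => h.trans_le (hle x)
  have hne : eqMeasure β W ≠ 0 := by
    intro hz
    have h1 := densityMeasure_univ hc hnn
    rw [← hμ, hz, Measure.coe_zero, Pi.zero_apply, eq_comm, ENNReal.ofReal_eq_zero] at h1
    have h2 := integral_mono (integrable_const _) (integrable_of_continuous hc) hle
    have h3 : 0 < ∫ _ : Torus, ⨅ x, eqDensity β W x := by
      rw [integral_const, smul_eq_mul, measureReal_def, AddCircle.measure_univ,
        ENNReal.toReal_ofReal Real.two_pi_pos.le]
      exact mul_pos Real.two_pi_pos h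
    linarith
  obtain ⟨μ, hμ1, hmin⟩ := exists_minimizer_of_eqMeasure_ne_zero β W hne
  have h1 : ∫ x, eqDensity β W x = 1 := by
    have h2 := densityMeasure_univ hc hnn
    rw [← hμ, ← hμ1, measure_univ, eq_comm, ENNReal.ofReal_eq_one] at h2
    exact h2
  exact ⟨h, hc, hle, hμ, h1,
    exists_hasL2Deriv_log_of_minimizer hβ hc hpos h1 hW hW' (hμ1.trans hμ) hmin⟩

/-! ### The operator in terms of `u = μ_β φ'` -/

theorem HasL2Deriv.integral_eq_zero {f g : Torus → ℝ} (h : HasL2Deriv f g) : ∫ x, g x = 0 := by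
  have h0 := h.coeff 0
  rw [realCoeff_zero_index, Int.cast_zero, mul_zero, zero_mul, Complex.ofReal_eq_zero] at h0
  exact (mul_eq_zero.1 h0).resolve_left (inv_ne_zero Real.two_pi_pos.ne')

theorem HasL2Deriv.integral_deriv_mul {f f' g g' : Torus → ℝ} (hf : HasL2Deriv f f')
    (hg : HasL2Deriv g g') : ∫ x, f' x * g x = -∫ x, f x * g' x := by
  have h := (hf.mul hg).integral_eq_zero
  have i1 : Integrable fun x => f' x * g x := hf.memLp_deriv.integrable_mul hg.memLp
  have i2 : Integrable fun x => g' x * f x := hg.memLp_deriv.integrable_mul hf.memLp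
  rw [integral_add i1 i2] at h
  simp only [mul_comm (g' _)] at h
  linarith

theorem IsRegular.pos {β : ℝ} {W : Torus → ℝ} (R : IsRegular β W) (x : Torus) :
    0 < eqDensity β W x := R.iInf_pos.trans_le (R.iInf_le x)

theorem IsRegular.continuous_log {β : ℝ} {W : Torus → ℝ} (R : IsRegular β W) :
    Continuous fun x => Real.log (eqDensity β W x) := R.continuous.log fun x => (R.pos x).ne'

theorem IsRegular.hasL2Deriv_density {β : ℝ} {W l' : Torus → ℝ} (R : IsRegular β W)
    (hl : HasL2Deriv (fun x => Real.log (eqDensity β W x)) l') :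
    HasL2Deriv (eqDensity β W) (fun x => eqDensity β W x * l' x) := by
  have h := hl.exp R.continuous_log
  simpa only [Real.exp_log (R.pos _)] using h

theorem IsRegular.hasL2Deriv_inv {β : ℝ} {W l' : Torus → ℝ} (R : IsRegular β W)
    (hl : HasL2Deriv (fun x => Real.log (eqDensity β W x)) l') :
    HasL2Deriv (fun x => (eqDensity β W x)⁻¹) (fun x => (eqDensity β W x)⁻¹ * (-1 * l' x)) := by
  have h := (hl.const_mul (-1)).exp (continuous_const.mul R.continuous_log)
  have e : ∀ x, Real.exp (-1 * Real.log (eqDensity β W x)) = (eqDensity β W x)⁻¹ := fun x => by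
    rw [neg_one_mul, Real.exp_neg, Real.exp_log (R.pos x)]
  simpa only [e] using h

theorem IsRegular.ae_volume_to_eqMeasure {β : ℝ} {W : Torus → ℝ} (R : IsRegular β W)
    {f g : Torus → ℝ} (h : f =ᵐ[volume] g) : f =ᵐ[eqMeasure β W] g := by
  rw [R.measure_eq]; exact (densityMeasure_absolutelyContinuous _).ae_le h

theorem IsRegular.integral_eqMeasure {β : ℝ} {W : Torus → ℝ} (R : IsRegular β W)
    (g : Torus → ℝ) : ∫ x, g x ∂eqMeasure β W = ∫ x, eqDensity β W x * g x := by
  rw [R.measure_eq, integral_densityMeasure R.continuous fun x => (R.pos x).le]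

/-- The local part of the operator is in divergence form, `φ'' + (log m)' φ' = (m φ')' / m`, by the
product rule for `m φ'`. -/
theorem IsRegular.opL_ae_eq {β : ℝ} {W φ p q : Torus → ℝ} (R : IsRegular β W)
    (hp : HasL2Deriv φ p) (hq : HasL2Deriv p q) :
    ∃ g, HasL2Deriv (fun x => eqDensity β W x * weakDeriv φ x) g ∧
      opL β W φ =ᵐ[volume] fun x => -(g x / eqDensity β W x
        + 2 * π * β * hilbert (fun t => eqDensity β W t * weakDeriv φ t) x) := by
  obtain ⟨l', hl⟩ := R.exists_deriv_log
  have hp0 : HasL2Deriv (weakDeriv φ) (weakDeriv (weakDeriv φ)) :=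
    (hq.congr hp.weakDeriv_ae_eq.symm (ae_eq_refl q)).weakDeriv
  refine ⟨_, (R.hasL2Deriv_density hl).mul hp0, ?_⟩
  filter_upwards [hl.weakDeriv_ae_eq] with x hx
  have h0 := (R.pos x).ne'
  rw [opL, hx]
  field_simp
  ring

theorem memLp_centered {β : ℝ} {W ψ : Torus → ℝ} (hψ : MemLp ψ 2 volume) :
    MemLp (centered β W ψ) 2 volume := hψ.sub (memLp_const _)

theorem hasL2Deriv_centered {β : ℝ} {W ψ ψ' : Torus → ℝ} (hψ : HasL2Deriv ψ ψ') :
    HasL2Deriv (centered β W ψ) ψ' := by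
  have h := hψ.add (hasL2Deriv_const (-∫ y, ψ y ∂eqMeasure β W))
  simp only [add_zero, ← sub_eq_add_neg] at h
  exact h

/-! ### The energy estimate -/

theorem integrable_fun_add {f g : Torus → ℝ} (hf : Integrable f) (hg : Integrable g) :
    Integrable fun x => f x + g x := hf.add hg

/-- Parseval gives the sum of `|k| |ψ̂_k|²` over all integers; for real `ψ` the terms at `k` and
`-k` agree, which produces the factor `2`. -/
theorem hHalfSq_eq_neg_integral {ψ ψ' w : Torus → ℝ} (hψ : HasL2Deriv ψ ψ') (hw : MemLp w 2 volume)
    (hwc : ∀ k : ℤ, realCoeff w k = -(((|k| : ℤ) : ℂ) / ((2 * π : ℝ) : ℂ)) * realCoeff ψ k) :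
    hHalfSq ψ = -∫ x, ψ x * w x := by
  have h := (hasSum_realCoeff_mul_conj hψ.memLp hw).mul_left (-((2 * π : ℝ) : ℂ))
  have hp : ((2 * π : ℝ) : ℂ) ≠ 0 := by exact_mod_cast Real.two_pi_pos.ne'
  have e1 : ∀ k : ℤ, -((2 * π : ℝ) : ℂ) * (realCoeff ψ k * conj (realCoeff w k)) =
      ((((|k| : ℤ) : ℝ) * ‖realCoeff ψ k‖ ^ 2 : ℝ) : ℂ) := fun k => by
    rw [hwc, map_mul, map_neg, map_div₀, Complex.conj_ofReal, map_intCast]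
    have h2 := Complex.mul_conj (realCoeff ψ k)
    rw [Complex.normSq_eq_norm_sq] at h2
    rw [Complex.ofReal_mul ((|k| : ℤ) : ℝ), ← h2, Complex.ofReal_intCast]
    field_simp
  simp only [e1] at h
  rw [← Complex.ofReal_neg, ← Complex.ofReal_mul, Complex.hasSum_ofReal, neg_mul,
    mul_inv_cancel_left₀ Real.two_pi_pos.ne'] at h
  have h2 := h.nat_add_neg
  simp only [abs_zero, Int.cast_zero, zero_mul, add_zero] at h2
  have e2 : ∀ n : ℕ, ((|(n : ℤ)| : ℤ) : ℝ) * ‖realCoeff ψ n‖ ^ 2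
      + ((|-(n : ℤ)| : ℤ) : ℝ) * ‖realCoeff ψ (-n)‖ ^ 2 = 2 * ((n : ℝ) * ‖realCoeff ψ n‖ ^ 2) := by
    intro n
    rw [realCoeff_neg, RCLike.norm_conj, abs_neg, Nat.abs_cast]
    push_cast; ring
  simp only [e2] at h2
  rw [← h2.tsum_eq, tsum_mul_left]
  rfl

/-- The approximate solution `w = -|D| ψ / 2π`. -/
theorem exists_limit_profile {ψ ψ' : Torus → ℝ} (hψ : HasL2Deriv ψ ψ') :
    ∃ w : Torus → ℝ, MemLp w 2 volume ∧
      ∀ k : ℤ, realCoeff w k = -(((|k| : ℤ) : ℂ) / ((2 * π : ℝ) : ℂ)) * realCoeff ψ k := by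
  obtain ⟨u, hu, huc⟩ := exists_hilbertCoeff hψ.memLp_deriv
  refine ⟨fun x => (2 * π)⁻¹ * u x, hu.const_mul _, fun k => ?_⟩
  -- The profile is `Hψ' / 2π`: the multipliers combine to `(i sgn k)(i k) = -|k|`.
  rw [realCoeff_const_mul, huc, hilbertCoeff, hψ.coeff]
  have hI := Complex.I_mul_I
  have hk : ((|k| : ℤ) : ℂ) = (k.sign : ℂ) * (k : ℂ) := by
    rw [← Int.cast_mul, Int.sign_mul_self_eq_abs]
  rw [hk]
  push_cast
  linear_combination ((2 * (π : ℂ))⁻¹ * (k.sign : ℂ) * k * realCoeff ψ k) * hI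

/-- Here `h` stands for `Hu`, `ρ` is the error in `βg ≈ w`, and `τ` satisfies `ρ = |D| τ`. The
quantity to bound is `-∫ ψ ρ = 2π ∫ w τ`, which the equation expresses through integrals weighted by
`v = 1 / (βm) ≤ 1 / (βδ)`. -/
theorem energy_estimate {β δ c : ℝ} (hβ : 0 < β) (hδ : 0 < δ) {m u g h ψ ψ' w : Torus → ℝ}
    (hm : Continuous m) (hmδ : ∀ x, δ ≤ m x) (hu : HasL2Deriv u g) (hh : MemLp h 2 volume)
    (hhc : ∀ k, realCoeff h k = hilbertCoeff u k) (hψ : HasL2Deriv ψ ψ') (hw : MemLp w 2 volume)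
    (hwc : ∀ k : ℤ, realCoeff w k = -(((|k| : ℤ) : ℂ) / ((2 * π : ℝ) : ℂ)) * realCoeff ψ k)
    (heq : ∀ᵐ x, g x / m x + 2 * π * β * h x = -ψ x + c) :
    |β * (-∫ x, ψ x * g x) - hHalfSq ψ| ≤ 2 * (∫ x, w x ^ 2) / (β * δ) := by
  have hg := hu.memLp_deriv
  have hψ0 := hψ.memLp
  have hpC : ((2 * π : ℝ) : ℂ) ≠ 0 := by exact_mod_cast Real.two_pi_pos.ne'
  set ρ : Torus → ℝ := fun x => β * g x + (-1) * w x with hρdef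
  set τ : Torus → ℝ := fun x => β * h x + (2 * π)⁻¹ * ψ x with hτdef
  have hρ : MemLp ρ 2 volume := (hg.const_mul β).add (hw.const_mul (-1))
  have hτ : MemLp τ 2 volume := (hh.const_mul β).add (hψ0.const_mul _)
  have hρc : ∀ k : ℤ, realCoeff ρ k = ((|k| : ℤ) : ℂ) * realCoeff τ k := fun k => by
    rw [hρdef, hτdef, realCoeff_add ((integrable_of_memLp_two hg).const_mul _)
      ((integrable_of_memLp_two hw).const_mul _), realCoeff_add
      ((integrable_of_memLp_two hh).const_mul _) ((integrable_of_memLp_two hψ0).const_mul _)]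
    simp only [realCoeff_const_mul]
    rw [hhc, hilbertCoeff, hu.coeff, hwc]
    have hk : ((|k| : ℤ) : ℂ) * (k.sign : ℂ) = (k : ℂ) := by
      rw [← Int.cast_mul, mul_comm, Int.sign_mul_abs]
    push_cast
    linear_combination (-(β : ℂ) * Complex.I * realCoeff u k) * hk
  have hρ0 : ∫ x, ρ x = 0 := by
    have h0 := hρc 0
    rw [realCoeff_zero_index, abs_zero, Int.cast_zero, zero_mul, Complex.ofReal_eq_zero] at h0
    exact (mul_eq_zero.1 h0).resolve_left (inv_ne_zero Real.two_pi_pos.ne')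
  have hw0 : ∫ x, w x = 0 := by
    have h0 := hwc 0
    rw [realCoeff_zero_index, abs_zero, Int.cast_zero, zero_div, neg_zero, zero_mul,
      Complex.ofReal_eq_zero] at h0
    exact (mul_eq_zero.1 h0).resolve_left (inv_ne_zero Real.two_pi_pos.ne')
  have hρτ : 0 ≤ ∫ x, ρ x * τ x := by
    have h1 := hasSum_realCoeff_mul_conj hρ hτ
    have e : ∀ k : ℤ, realCoeff ρ k * conj (realCoeff τ k)
        = ((((|k| : ℤ) : ℝ) * ‖realCoeff τ k‖ ^ 2 : ℝ) : ℂ) := fun k => by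
      rw [hρc, mul_assoc, Complex.mul_conj, Complex.normSq_eq_norm_sq,
        Complex.ofReal_mul, Complex.ofReal_intCast]
    simp only [e] at h1
    rw [Complex.hasSum_ofReal] at h1
    have h2 := h1.nonneg fun k => by positivity
    exact nonneg_of_mul_nonneg_right h2 (inv_pos.2 Real.two_pi_pos)
  have hwτ : 2 * π * ∫ x, w x * τ x = -∫ x, ψ x * ρ x := by
    have h1 := (hasSum_realCoeff_mul_conj hw hτ).mul_left (((2 * π : ℝ) : ℂ))
    have h2 := (hasSum_realCoeff_mul_conj hψ0 hρ).neg
    have e : ∀ k : ℤ, ((2 * π : ℝ) : ℂ) * (realCoeff w k * conj (realCoeff τ k))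
        = -(realCoeff ψ k * conj (realCoeff ρ k)) := fun k => by
      rw [hρc, hwc, map_mul, map_intCast]
      push_cast at hpC ⊢
      field_simp
    simp only [e] at h1
    have h3 := h1.unique h2
    rw [← Complex.ofReal_mul, ← Complex.ofReal_neg, Complex.ofReal_inj] at h3
    rw [mul_inv_cancel_left₀ Real.two_pi_pos.ne', ← mul_neg] at h3
    rw [h3, mul_inv_cancel_left₀ Real.two_pi_pos.ne']
  set v : Torus → ℝ := fun x => (β * m x)⁻¹ with hvdef
  have hm0 : ∀ x, 0 < m x := fun x => hδ.trans_le (hmδ x)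
  have hv0 : ∀ x, 0 < v x := fun x => inv_pos.2 (mul_pos hβ (hm0 x))
  have hvc : Continuous v :=
    (continuous_const.mul hm).inv₀ fun x => (mul_pos hβ (hm0 x)).ne'
  have hvb : ∀ x, v x ≤ (β * δ)⁻¹ := fun x =>
    inv_anti₀ (mul_pos hβ hδ) (mul_le_mul_of_nonneg_left (hmδ x) hβ.le)
  have hvi : ∀ {a b : Torus → ℝ}, MemLp a 2 volume → MemLp b 2 volume →
      Integrable fun x => v x * (a x * b x) := fun ha hb =>
    (ha.integrable_mul hb).bdd_mul (c := (β * δ)⁻¹) hvc.aestronglyMeasurable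
      (ae_of_all _ fun x => by rw [Real.norm_of_nonneg (hv0 x).le]; exact hvb x)
  have heq2 : ∀ᵐ x, v x * (ρ x + w x) + 2 * π * τ x = c := by
    filter_upwards [heq] with x hx
    have h1 := (hm0 x).ne'
    have h2 := hβ.ne'
    have h3 := Real.pi_ne_zero
    have e : v x * (ρ x + w x) = g x / m x := by
      simp only [hvdef, hρdef]; field_simp; ring
    rw [e, hτdef]
    have e2 : 2 * π * (β * h x + (2 * π)⁻¹ * ψ x) = 2 * π * β * h x + ψ x := by
      field_simp
    simp only [e2]
    linarith
  -- Testing the equation against mean-zero functions eliminates the unknown constant `c`.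
  have hpair : ∀ {a : Torus → ℝ}, MemLp a 2 volume → ∫ x, a x = 0 →
      (∫ x, v x * (a x * ρ x)) + (∫ x, v x * (a x * w x)) + 2 * π * ∫ x, a x * τ x = 0 := by
    intro a ha ha0
    have i1 : Integrable fun x => a x * τ x := ha.integrable_mul hτ
    rw [← integral_const_mul, ← integral_add (hvi ha hρ) (hvi ha hw),
      ← integral_add (integrable_fun_add (hvi ha hρ) (hvi ha hw)) (i1.const_mul _)]
    have e : ∫ x, c * a x = 0 := by rw [integral_const_mul, ha0, mul_zero]
    rw [← e]
    apply integral_congr_ae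
    filter_upwards [heq2] with x hx
    rw [← hx]; ring
  have P1 := hpair hρ hρ0
  have P2 := hpair hw hw0
  have hsq : ∀ s : ℝ, s ^ 2 = 1 → 0 ≤ (∫ x, v x * (ρ x * ρ x)) + 2 * s * (∫ x, v x * (ρ x * w x))
      + ∫ x, v x * (w x * w x) := by
    intro s hs
    rw [← integral_const_mul, ← integral_add (hvi hρ hρ) ((hvi hρ hw).const_mul _),
      ← integral_add (integrable_fun_add (hvi hρ hρ) ((hvi hρ hw).const_mul _)) (hvi hw hw)]
    refine integral_nonneg fun x => ?_
    have := mul_nonneg (hv0 x).le (sq_nonneg (ρ x + s * w x))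
    have e : v x * (ρ x + s * w x) ^ 2 = v x * (ρ x * ρ x) + 2 * s * (v x * (ρ x * w x))
      + s ^ 2 * (v x * (w x * w x)) := by ring
    rw [e, hs, one_mul] at this
    exact this
  have s1 := hsq 1 (by norm_num)
  have s2 := hsq (-1) (by norm_num)
  have hsymm : ∫ x, v x * (w x * ρ x) = ∫ x, v x * (ρ x * w x) := by
    congr 1; funext x; ring
  have hC : ∫ x, v x * (w x * w x) ≤ (∫ x, w x ^ 2) / (β * δ) := by
    rw [div_eq_inv_mul, ← integral_const_mul]
    refine integral_mono (hvi hw hw) (hw.integrable_sq.const_mul _) fun x => ?_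
    have := mul_le_mul_of_nonneg_right (hvb x) (mul_self_nonneg (w x))
    rwa [← sq] at this ⊢
  have hH := hHalfSq_eq_neg_integral hψ hw hwc
  have hsplit : β * (-∫ x, ψ x * g x) - hHalfSq ψ = -∫ x, ψ x * ρ x := by
    have i1 : Integrable fun x => ψ x * g x := hψ0.integrable_mul hg
    have i2 : Integrable fun x => ψ x * w x := hψ0.integrable_mul hw
    have e : ∀ x, ψ x * ρ x = β * (ψ x * g x) - ψ x * w x := fun x => by
      simp only [hρdef]; ring
    simp only [e]
    rw [hH, integral_sub (i1.const_mul β) i2, integral_const_mul]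
    ring
  rw [hsplit, ← hwτ]
  have hπ := Real.pi_pos
  have P3 : 0 ≤ 2 * π * ∫ x, ρ x * τ x := by positivity
  rw [hsymm] at P2
  -- With `B = ∫ v ρ w` and `C = ∫ v w²`, `P1` and `P3` give `∫ v ρ² ≤ -B`; the two squares then
  -- yield `-C ≤ B ≤ C / 3`. By `P2` the error is `-(B + C)`, hence at most `2C` in absolute value.
  rw [mul_div_assoc, abs_le]
  constructor <;> linarith

/-! ### Operators on the real `L²` space -/

/-- The real `L²` space of the torus. -/
abbrev L2Torus : Type := Lp ℝ 2 (volume : Measure Torus)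

theorem inner_eq_integral (f g : L2Torus) : inner ℝ f g = ∫ x, f x * g x := by
  rw [L2.inner_def]
  congr 1; funext x
  rw [RCLike.inner_apply, conj_trivial, mul_comm]

theorem norm_sq_eq_integral (f : L2Torus) : ‖f‖ ^ 2 = ∫ x, f x ^ 2 := by
  rw [← real_inner_self_eq_norm_sq, inner_eq_integral]
  simp only [sq]

theorem hasSum_norm_sq (f : L2Torus) :
    HasSum (fun k => ‖realCoeff f k‖ ^ 2) ((2 * π)⁻¹ * ‖f‖ ^ 2) := by
  rw [norm_sq_eq_integral]; exact hasSum_norm_sq_realCoeff (Lp.memLp f)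

theorem ext_realCoeff {f g : L2Torus} (h : ∀ k, realCoeff f k = realCoeff g k) : f = g :=
  Lp.ext (ae_eq_of_realCoeff_eq (Lp.memLp f) (Lp.memLp g) h)

theorem realCoeff_Lp_add (f g : L2Torus) (k : ℤ) :
    realCoeff (f + g : L2Torus) k = realCoeff f k + realCoeff g k := by
  rw [realCoeff_congr (Lp.coeFn_add f g)]
  exact realCoeff_add (integrable_of_memLp_two (Lp.memLp f))
    (integrable_of_memLp_two (Lp.memLp g)) k

theorem realCoeff_Lp_smul (c : ℝ) (f : L2Torus) (k : ℤ) :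
    realCoeff (c • f : L2Torus) k = c * realCoeff f k := by
  rw [realCoeff_congr (Lp.coeFn_smul c f)]
  exact realCoeff_const_mul c f k

/-- Multiplication by a continuous function. -/
theorem exists_mulOp {r : Torus → ℝ} (hr : Continuous r) :
    ∃ A : L2Torus →L[ℝ] L2Torus, ∀ f : L2Torus, A f =ᵐ[volume] fun x => r x * f x := by
  obtain ⟨M, -, hM⟩ := exists_bound hr
  have hmem : ∀ f : L2Torus, MemLp (fun x => r x * f x) 2 volume := fun f => by
    simpa only [mul_comm] using memLp_two_mul_top (Lp.memLp f) (memLp_of_continuous hr ⊤)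
  let A : L2Torus →ₗ[ℝ] L2Torus :=
    { toFun := fun f => (hmem f).toLp _
      map_add' := fun f g => by
        refine Lp.ext ?_
        filter_upwards [(hmem (f + g)).coeFn_toLp, (hmem f).coeFn_toLp, (hmem g).coeFn_toLp,
          Lp.coeFn_add ((hmem f).toLp _) ((hmem g).toLp _), Lp.coeFn_add f g] with x h1 h2 h3 h4 h5
        rw [h1, h4, Pi.add_apply, h2, h3, h5, Pi.add_apply, mul_add]
      map_smul' := fun c f => by
        refine Lp.ext ?_
        filter_upwards [(hmem (c • f)).coeFn_toLp, (hmem f).coeFn_toLp,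
          Lp.coeFn_smul c ((hmem f).toLp _), Lp.coeFn_smul c f] with x h1 h2 h3 h4
        rw [RingHom.id_apply, h1, h3, Pi.smul_apply, h2, h4, Pi.smul_apply, smul_eq_mul,
          smul_eq_mul, mul_left_comm] }
  refine ⟨A.mkContinuous M fun f => ?_, fun f => (hmem f).coeFn_toLp⟩
  refine Lp.norm_le_mul_norm_of_ae_le_mul ?_
  filter_upwards [(hmem f).coeFn_toLp] with x hx
  change ‖(hmem f).toLp _ x‖ ≤ _
  rw [hx, norm_mul]
  exact mul_le_mul_of_nonneg_right (hM x) (norm_nonneg _)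

/-- Fourier multipliers bounded by `1`. -/
theorem exists_multiplier {d : ℤ → ℝ} (hd : ∀ k, |d k| ≤ 1) (hd' : ∀ k, d (-k) = d k) :
    ∃ A : L2Torus →L[ℝ] L2Torus, ∀ (f : L2Torus) (k : ℤ),
      realCoeff (A f) k = d k * realCoeff f k := by
  have hle : ∀ (f : L2Torus) (k : ℤ), ‖(d k : ℂ) * realCoeff f k‖ ≤ ‖realCoeff f k‖ := fun f k => by
    rw [norm_mul, Complex.norm_real]
    exact mul_le_of_le_one_left (norm_nonneg _) (hd k)
  have hex : ∀ f : L2Torus, ∃ g : L2Torus, ∀ k, realCoeff g k = d k * realCoeff f k := fun f => by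
    obtain ⟨g, hg, hgc⟩ := exists_memLp_realCoeff (a := fun k => (d k : ℂ) * realCoeff f k)
      ((hasSum_norm_sq f).summable.of_nonneg_of_le (fun k => by positivity)
        fun k => by gcongr; exact hle f k)
      (fun k => by rw [realCoeff_neg, hd', map_mul, Complex.conj_ofReal])
    exact ⟨hg.toLp g, fun k => by rw [realCoeff_congr hg.coeFn_toLp, hgc]⟩
  choose S hS using hex
  let A : L2Torus →ₗ[ℝ] L2Torus :=
    { toFun := S
      map_add' := fun f g => ext_realCoeff fun k => by
        rw [hS, realCoeff_Lp_add, realCoeff_Lp_add, hS, hS, mul_add]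
      map_smul' := fun c f => ext_realCoeff fun k => by
        rw [RingHom.id_apply, hS, realCoeff_Lp_smul, realCoeff_Lp_smul, hS, mul_left_comm] }
  refine ⟨A.mkContinuous 1 fun f => ?_, hS⟩
  rw [one_mul]
  have h1 := hasSum_norm_sq (S f)
  have h2 := hasSum_norm_sq f
  have h3 := hasSum_le (fun k => by
    rw [hS]
    exact pow_le_pow_left₀ (norm_nonneg _) (hle f k) 2) h1 h2
  have h4 := le_of_mul_le_mul_left h3 (inv_pos.2 Real.two_pi_pos)
  exact (pow_le_pow_iff_left₀ (norm_nonneg _) (norm_nonneg _) two_ne_zero).1 h4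

/-! ### Solving the linearised equation -/

/-- The mean-zero solution `g` of `g / m + 2πβ |D|⁻¹ g = f + const`. -/
theorem exists_solution {β : ℝ} (hβ : 0 ≤ β) {m f : Torus → ℝ} (hm : Continuous m)
    (hm0 : ∀ x, 0 < m x) (hf : MemLp f 2 volume) :
    ∃ (g h : Torus → ℝ) (c : ℝ), MemLp g 2 volume ∧ MemLp h 2 volume ∧ ∫ x, g x = 0 ∧
      (∀ k : ℤ, realCoeff h k = ((|(k : ℝ)|⁻¹ : ℝ) : ℂ) * realCoeff g k) ∧
      ∀ᵐ x, g x / m x + 2 * π * β * h x = f x + c := by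
  have hrc : Continuous fun x => (m x)⁻¹ := hm.inv₀ fun x => (hm0 x).ne'
  obtain ⟨A, hA⟩ := exists_mulOp hrc
  -- The multiplier is `0` at `k = 0`, so this is `|D|⁻¹` annihilating constants: nonnegative and
  -- bounded by `1`.
  obtain ⟨S, hS⟩ := exists_multiplier (d := fun k => |(k : ℝ)|⁻¹)
    (fun k => by
      rw [abs_inv, abs_abs]
      by_cases hk : k = 0
      · simp [hk]
      · exact inv_le_one_of_one_le₀ (by exact_mod_cast Int.one_le_abs hk))
    (fun k => by simp)
  obtain ⟨M, hM0, hM⟩ := exists_bound hm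
  have hSpos : ∀ u : L2Torus, 0 ≤ inner ℝ (S u) u := fun u => by
    have h1 := hasSum_realCoeff_mul_conj (Lp.memLp (S u)) (Lp.memLp u)
    have e : ∀ k : ℤ, realCoeff (S u) k * conj (realCoeff u k)
        = ((|(k : ℝ)|⁻¹ * ‖realCoeff u k‖ ^ 2 : ℝ) : ℂ) := fun k => by
      rw [hS, mul_assoc, Complex.mul_conj, Complex.normSq_eq_norm_sq, Complex.ofReal_mul]
    simp only [e] at h1
    rw [Complex.hasSum_ofReal] at h1
    rw [inner_eq_integral]
    exact nonneg_of_mul_nonneg_right (h1.nonneg fun k => by positivity)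
      (inv_pos.2 Real.two_pi_pos)
  have hAcoer : ∀ u : L2Torus, (M + 1)⁻¹ * ‖u‖ ^ 2 ≤ inner ℝ (A u) u := fun u => by
    have e : inner ℝ (A u) u = ∫ x, (m x)⁻¹ * u x ^ 2 := by
      rw [inner_eq_integral]
      apply integral_congr_ae
      filter_upwards [hA u] with x hx
      rw [hx]; ring
    have hi := (Lp.memLp u).integrable_sq
    obtain ⟨B, -, hB⟩ := exists_bound hrc
    rw [e, norm_sq_eq_integral, ← integral_const_mul]
    refine integral_mono (hi.const_mul _)
      (hi.bdd_mul (c := B) hrc.aestronglyMeasurable (ae_of_all _ hB)) fun x => ?_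
    refine mul_le_mul_of_nonneg_right (inv_anti₀ (hm0 x) ?_) (sq_nonneg _)
    linarith [le_abs_self (m x), hM x]
  have hc : 0 < (M + 1)⁻¹ := inv_pos.2 (by linarith)
  have hcoer : ∀ u : L2Torus, (M + 1)⁻¹ * ‖u‖ ^ 2 ≤ inner ℝ ((A + (2 * π * β) • S) u) u :=
    fun u => by
      have h1 : inner ℝ ((A + (2 * π * β) • S) u) u
          = inner ℝ (A u) u + (2 * π * β) * inner ℝ (S u) u := by
        rw [add_apply, inner_add_left, smul_apply,
          real_inner_smul_left]
      have h2 := mul_nonneg (mul_nonneg Real.two_pi_pos.le hβ) (hSpos u)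
      linarith [hAcoer u]
  -- Lax–Milgram: multiplication by `1 / m` is coercive and the multiplier only adds a nonnegative
  -- form.
  have hunit : IsUnit (A + (2 * π * β) • S) := by
    refine ContinuousLinearMap.isUnit_of_forall_le_norm_inner_map _ (c := ⟨(M + 1)⁻¹, hc.le⟩) hc
      fun u => ?_
    rw [mul_comm]
    exact (hcoer u).trans (le_abs_self _)
  have hsurj := (ContinuousLinearMap.isUnit_iff_bijective.1 hunit).2
  have h1mem : MemLp (fun _ : Torus => (1 : ℝ)) 2 volume := memLp_const 1
  obtain ⟨a, ha⟩ := hsurj (hf.toLp f)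
  obtain ⟨b, hb⟩ := hsurj (h1mem.toLp _)
  have hone : ∀ u : L2Torus, inner ℝ (h1mem.toLp _) u = ∫ x, u x := fun u => by
    rw [inner_eq_integral]
    apply integral_congr_ae
    filter_upwards [h1mem.coeFn_toLp] with x hx
    rw [hx, one_mul]
  have hbpos : 0 < ∫ x, b x := by
    have h := hcoer b
    rw [hb, hone] at h
    refine lt_of_lt_of_le (mul_pos hc (pow_pos (norm_pos_iff.2 ?_) 2)) h
    rintro rfl
    rw [map_zero] at hb
    have h2 := hone (h1mem.toLp _)
    rw [integral_congr_ae h1mem.coeFn_toLp, ← hb, inner_zero_left, integral_const, smul_eq_mul,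
      mul_one, measureReal_def, AddCircle.measure_univ,
      ENNReal.toReal_ofReal Real.two_pi_pos.le] at h2
    exact Real.two_pi_pos.ne h2
  -- The constant on the right is the Lagrange multiplier of the mean-zero constraint: adding `s`
  -- times the solution `b` with right-hand side `1` makes the mean vanish. Coercivity makes `∫ b`
  -- positive.
  set s : ℝ := -(∫ x, a x) / ∫ x, b x with hs
  have hL : (A + (2 * π * β) • S) (a + s • b) = hf.toLp f + s • h1mem.toLp _ := by
    rw [map_add, map_smul, ha, hb]
  refine ⟨(a + s • b : L2Torus), S (a + s • b), s, Lp.memLp _, Lp.memLp _, ?_, hS _, ?_⟩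
  · rw [← hone, inner_add_right, real_inner_smul_right, hone, hone, hs]
    field_simp
    ring
  · have h3 : A (a + s • b) + (2 * π * β) • S (a + s • b) = hf.toLp f + s • h1mem.toLp _ := by
      rw [← hL]; rfl
    have h4 := congrArg (fun u : L2Torus => (u : Torus → ℝ)) h3
    filter_upwards [hA (a + s • b), Lp.coeFn_add (A (a + s • b)) ((2 * π * β) • S (a + s • b)),
      Lp.coeFn_smul (2 * π * β) (S (a + s • b)), Lp.coeFn_add (hf.toLp f) (s • h1mem.toLp _),
      Lp.coeFn_smul s (h1mem.toLp _), hf.coeFn_toLp, h1mem.coeFn_toLp]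
      with x e1 e2 e3 e4 e5 e6 e7
    have h5 := congrFun h4 x
    rw [e2, e4, Pi.add_apply, Pi.add_apply, e3, e5, Pi.smul_apply, Pi.smul_apply, e1, e6, e7,
      smul_eq_mul, smul_eq_mul, mul_one] at h5
    rw [← h5]
    ring

/-! ### The inverse of the operator -/

theorem HasL2Deriv.add_const {f f' : Torus → ℝ} (h : HasL2Deriv f f') (c : ℝ) :
    HasL2Deriv (fun x => f x + c) f' := by
  have h2 := h.add (hasL2Deriv_const c)
  simpa only [add_zero] using h2

/-- Solve for `g`, integrate to `u`, divide by `m` to get `φ'`, and integrate again. Membership of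
`1 / m` in `H¹` is what places `φ` in `H²`. -/
theorem IsRegular.exists_isInvL {β : ℝ} (hβ : 0 ≤ β) {W : Torus → ℝ} (R : IsRegular β W)
    {f : Torus → ℝ} (hf : MemLp f 2 volume) (hf0 : ∫ x, f x ∂eqMeasure β W = 0) :
    ∃ φ, IsInvL β W f φ := by
  set m := eqDensity β W with hm
  have hmc : Continuous m := R.continuous
  have hm0 : ∀ x, 0 < m x := R.pos
  have hic : Continuous fun x => (m x)⁻¹ := hmc.inv₀ fun x => (hm0 x).ne'
  obtain ⟨g, h, c, hg, hh, hg0, hhc, heq⟩ := exists_solution hβ hmc hm0 (f := fun x => -1 * f x)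
    (hf.const_mul _)
  obtain ⟨u₀, hu₀⟩ := exists_hasL2Deriv hg hg0
  obtain ⟨l', hl⟩ := R.exists_deriv_log
  have hipos : 0 < ∫ x, (m x)⁻¹ :=
    hic.integral_pos_of_hasCompactSupport_nonneg_nonzero
      (HasCompactSupport.of_compactSpace _) (fun x => (inv_pos.2 (hm0 x)).le)
      (inv_pos.2 (hm0 0)).ne'
  -- The integration constant in `u` is fixed by periodicity of `φ`: `u / m` must have mean zero. It
  -- changes neither `g` nor `Hu`.
  set t : ℝ := -(∫ x, u₀ x * (m x)⁻¹) / ∫ x, (m x)⁻¹ with ht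
  have hu := hu₀.add_const t
  have hp := hu.mul (R.hasL2Deriv_inv hl)
  have hp0 : ∫ x, (u₀ x + t) * (m x)⁻¹ = 0 := by
    have i1 : Integrable fun x => u₀ x * (m x)⁻¹ := hu₀.memLp.integrable_mul
      (memLp_of_continuous hic 2)
    simp only [add_mul]
    rw [integral_add i1 ((integrable_of_continuous hic).const_mul t), integral_const_mul, ht,
      div_mul_cancel₀ _ hipos.ne', add_neg_cancel]
  obtain ⟨φ₀, hφ₀⟩ := exists_hasL2Deriv hp.memLp hp0
  have hφ := hφ₀.add_const (-∫ x, φ₀ x ∂eqMeasure β W)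
  refine ⟨_, ⟨memH_one_iff.2 ⟨_, hφ⟩, ?_⟩, memH_two_iff.2 ⟨_, _, hφ, hp⟩, ?_⟩
  · rw [R.integral_eqMeasure, R.integral_eqMeasure]
    have i1 : Integrable fun x => m x * φ₀ x := (memLp_of_continuous hmc 2).integrable_mul hφ₀.memLp
    simp only [mul_add]
    rw [integral_add i1 ((integrable_of_continuous hmc).mul_const _), integral_mul_const,
      R.integral_eq_one]
    ring
  · obtain ⟨g₂, hg₂, hop⟩ := R.opL_ae_eq hφ hp
    have hu₂ : (fun x => m x * weakDeriv (fun x => φ₀ x + -∫ x, φ₀ x ∂eqMeasure β W) x)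
        =ᵐ[volume] fun x => u₀ x + t := by
      filter_upwards [hφ.weakDeriv_ae_eq] with x hx
      rw [hx, mul_comm, inv_mul_cancel_right₀ (hm0 x).ne']
    have hgg : g₂ =ᵐ[volume] g := hg₂.ae_unique (hu.congr hu₂.symm (ae_eq_refl g))
    obtain ⟨hH, hHc⟩ := hg₂.memLp_hilbert_and_realCoeff
    have hHh : hilbert (fun x => m x * weakDeriv (fun x => φ₀ x + -∫ x, φ₀ x ∂eqMeasure β W) x)
        =ᵐ[volume] h := by
      refine ae_eq_of_realCoeff_eq hH hh fun k => ?_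
      rw [hHc, hhc, hilbertCoeff, realCoeff_congr hu₂, hu.coeff]
      by_cases hk : k = 0
      · subst hk; simp
      · have hk' : ((|(k : ℝ)| : ℝ) : ℂ) ≠ 0 := by
          exact_mod_cast (abs_pos.2 (by exact_mod_cast hk : (k : ℝ) ≠ 0)).ne'
        have e : (k : ℂ) = (k.sign : ℂ) * ((|(k : ℝ)| : ℝ) : ℂ) := by
          rw [← Int.cast_abs, Complex.ofReal_intCast, ← Int.cast_mul, Int.sign_mul_abs]
        rw [Complex.ofReal_inv, eq_inv_mul_iff_mul_eq₀ hk']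
        linear_combination (-(Complex.I * realCoeff (fun x => u₀ x + t) k)) * e
    have hopL : opL β W (fun x => φ₀ x + -∫ x, φ₀ x ∂eqMeasure β W)
        =ᵐ[volume] fun x => f x + -c := by
      filter_upwards [hop, hgg, hHh, heq] with x h1 h2 h3 h4
      rw [h1, h2, h3, h4]
      ring
    have hmean : ∫ x, opL β W (fun x => φ₀ x + -∫ x, φ₀ x ∂eqMeasure β W) x ∂eqMeasure β W
        = -c := by
      rw [integral_congr_ae (R.ae_volume_to_eqMeasure hopL), R.integral_eqMeasure]
      rw [R.integral_eqMeasure] at hf0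
      have i1 : Integrable fun x => m x * f x := (memLp_of_continuous hmc 2).integrable_mul hf
      simp only [mul_add]
      rw [integral_add i1 ((integrable_of_continuous hmc).mul_const _), integral_mul_const,
        R.integral_eq_one, hf0]
      ring
    filter_upwards [hopL] with x hx
    rw [centered, hmean, hx]
    ring

theorem IsRegular.integral_centered {β : ℝ} {W : Torus → ℝ} (R : IsRegular β W)
    {ψ : Torus → ℝ} (hψ : MemLp ψ 2 volume) : ∫ x, centered β W ψ x ∂eqMeasure β W = 0 := by
  have i1 : Integrable fun x => eqDensity β W x * ψ x :=
    (memLp_of_continuous R.continuous 2).integrable_mul hψ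
  rw [R.integral_eqMeasure]
  simp only [centered, mul_sub]
  rw [integral_sub i1 ((integrable_of_continuous R.continuous).mul_const _), integral_mul_const,
    R.integral_eq_one, R.integral_eqMeasure]
  ring

/-- Integration by parts gives `σ² = ∫ ψ' (m φ') = -∫ ψ (m φ')'`, and both centerings merge into the
free constant of `energy_estimate`. -/
theorem IsRegular.abs_mul_sigmaSq_sub_le {β : ℝ} (hβ : 0 < β) {W : Torus → ℝ}
    (R : IsRegular β W) {ψ ψ' w : Torus → ℝ} (hψ : HasL2Deriv ψ ψ') (hw : MemLp w 2 volume)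
    (hwc : ∀ k : ℤ, realCoeff w k = -(((|k| : ℤ) : ℂ) / ((2 * π : ℝ) : ℂ)) * realCoeff ψ k) :
    |β * sigmaSq β W ψ - hHalfSq ψ| ≤ 2 * (∫ x, w x ^ 2) / (β * ⨅ x, eqDensity β W x) := by
  have hex := R.exists_isInvL hβ.le (memLp_centered hψ.memLp) (R.integral_centered hψ.memLp)
  have hinv : IsInvL β W (centered β W ψ) (invL β W (centered β W ψ)) := by
    rw [invL, dif_pos hex]; exact hex.choose_spec
  rw [sigmaSq]
  set φ := invL β W (centered β W ψ)
  obtain ⟨p, q, hp, hq⟩ := memH_two_iff.1 hinv.2.1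
  obtain ⟨g, hu, hop⟩ := R.opL_ae_eq hp hq
  obtain ⟨hH, hHc⟩ := hu.memLp_hilbert_and_realCoeff
  have hσ : innerHi β W (centered β W ψ) φ = -∫ x, ψ x * g x := by
    rw [innerHi, R.integral_eqMeasure, ← hψ.integral_deriv_mul hu]
    apply integral_congr_ae
    filter_upwards [(hasL2Deriv_centered (β := β) (W := W) hψ).weakDeriv_ae_eq] with x hx
    rw [hx]; ring
  rw [hσ]
  refine energy_estimate (c := (∫ y, ψ y ∂eqMeasure β W) - ∫ y, opL β W φ y ∂eqMeasure β W)
    hβ R.iInf_pos R.continuous R.iInf_le hu hH hHc hψ hw hwc ?_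
  filter_upwards [hop, hinv.2.2] with x h1 h2
  rw [centered, centered, h1] at h2
  linarith

/-! ### The limit -/

theorem IsC11.hasL2Deriv {V : Torus → ℝ} (hV : IsC11 V) :
    Continuous V ∧ HasL2Deriv V (torusDeriv V) := by
  obtain ⟨hd, K, hK⟩ := hV
  have hc : Continuous V := continuous_of_continuous_coe hd.continuous
  exact ⟨hc, memLp_of_continuous hc 2, memLp_of_continuous hK.continuous 2,
    realCoeff_torusDeriv hd hK.continuous⟩

/-- The profile `w` depends on `ψ` alone, so the error is a fixed constant over `β min m`. The
potential may therefore vary arbitrarily with `β`, which covers `V` and `βV` at once. -/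
theorem tendsto_mul_sigmaSq {W W' : ℝ → Torus → ℝ} (hW : ∀ β, Continuous (W β))
    (hW' : ∀ β, HasL2Deriv (W β) (W' β)) {ψ : Torus → ℝ} (hψ : MemH 1 ψ)
    (h : Tendsto (fun β : ℝ => β * ⨅ x, eqDensity β (W β) x) atTop atTop) :
    Tendsto (fun β : ℝ => β * sigmaSq β (W β) ψ) atTop (𝓝 (hHalfSq ψ)) := by
  obtain ⟨ψ', hψ'⟩ := memH_one_iff.1 hψ
  obtain ⟨w, hw, hwc⟩ := exists_limit_profile hψ'
  rw [tendsto_iff_norm_sub_tendsto_zero]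
  refine squeeze_zero' (Eventually.of_forall fun β => norm_nonneg _) ?_
    (h.const_div_atTop (2 * ∫ x, w x ^ 2))
  filter_upwards [eventually_gt_atTop 0, h.eventually_gt_atTop 0] with β hβ hpos
  exact (isRegular_of_iInf_pos hβ.le (hW β) (hW' β)
    ((pos_iff_pos_of_mul_pos hpos).1 hβ)).abs_mul_sigmaSq_sub_le hβ hψ' hw hwc

end

end TorusGas

theorem mainTheorem6 (V ψ : TorusGas.Torus → ℝ) (hV : TorusGas.IsC11 V)
    (hψ : TorusGas.MemH 2 ψ) :
    (Tendsto (fun β : ℝ => β * ⨅ x, TorusGas.eqDensity β V x) atTop atTop →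
      Tendsto (fun β : ℝ => β * TorusGas.sigmaSq β V ψ) atTop (𝓝 (TorusGas.hHalfSq ψ))) ∧
    (Tendsto (fun β : ℝ => β * ⨅ x, TorusGas.eqDensity β (fun y => β * V y) x) atTop atTop →
      Tendsto (fun β : ℝ => β * TorusGas.sigmaSq β (fun y => β * V y) ψ) atTop
        (𝓝 (TorusGas.hHalfSq ψ))) := by
  obtain ⟨hc, hV'⟩ := hV.hasL2Deriv
  have hψ1 : TorusGas.MemH 1 ψ := by
    obtain ⟨p, _, hp, -⟩ := TorusGas.memH_two_iff.1 hψ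
    exact TorusGas.memH_one_iff.2 ⟨p, hp⟩
  exact ⟨TorusGas.tendsto_mul_sigmaSq (fun _ => hc) (fun _ => hV') hψ1,
    TorusGas.tendsto_mul_sigmaSq (fun β => continuous_const.mul hc) (fun β => hV'.const_mul β) hψ1⟩
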